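/- **Theorem 4.1.** Let $V$ be a finite-dimensional real vector space, $G$ a finite group acting linearly on $V$, and $\Lambda\subset V$ a full lattice (the $\mathbb{Z}$-span of an $\mathbb{R}$-basis of $V$) that is mapped onto itself by $G$. Write $\mathrm{GL}(\Lambda)$ for the group of invertible $\mathbb{Z}$-linear maps $\Lambda\to\Lambda$, and $N_{\mathrm{GL}(\Lambda)}(G)$ for the normalizer in $\mathrm{GL}(\Lambda)$ of the image of $G$. A subspace $U\le V$ is called *$\Lambda$-rational* if $U\cap\Lambda$ contains an $\mathbb{R}$-basis of $U$, and *$\Lambda$-irrational* if $U\cap\Lambda=\{0\}$. Let $V=U_1\oplus\dots\oplus U_r$ be a decomposition of $V$ into irreducible $\mathbb{R}G$-subspaces. Then $N_{\mathrm{GL}(\Lambda)}(G)$ is finite if and only if all the $U_i$ are $\Lambda$-rational and the $U_i$ are pairwise non-isomorphic as $\mathbb{R}G$-modules. Consequently, $N_{\mathrm{GL}(\Lambda)}(G)$ is infinite whenever $V$ has a nonzero $G$-invariant $\Lambda$-irrational subspace (irreducible or not), and also whenever $U_i\cong U_j$ as $\mathbb{R}G$-modules for some $i\ne j$. -/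

import Mathlib

namespace LatticeRep

open Module

section Lattice

variable {V : Type*} [AddCommGroup V] [Module ℝ V]

/-- A full lattice in a real vector space: the `ℤ`-span of a (finite) `ℝ`-basis. -/
def IsFullLattice (L : Submodule ℤ V) : Prop :=
  ∃ (n : ℕ) (b : Basis (Fin n) ℝ V), L = Submodule.span ℤ (Set.range b)

/-- A subspace `U` is `L`-rational if `U ∩ L` contains a (finite) `ℝ`-basis of `U`. -/
def IsRational (L : Submodule ℤ V) (U : Submodule ℝ V) : Prop :=
  ∃ (n : ℕ) (b : Basis (Fin n) ℝ U), ∀ i, (b i : V) ∈ L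

/-- A subspace `U` is `L`-irrational if `U ∩ L = {0}`. -/
def IsIrrational (L : Submodule ℤ V) (U : Submodule ℝ V) : Prop :=
  (U : Set V) ∩ (L : Set V) = {0}

end Lattice

section Action

variable {V G : Type*} [AddCommGroup V] [Module ℝ V] [Group G]

/-- The action of `G` on an invariant lattice `L`, as a representation over `ℤ`. -/
def latticeRep (ρ : Representation ℝ G V) (L : Submodule ℤ V)
    (hL : ∀ (g : G), ∀ v ∈ L, ρ g v ∈ L) : Representation ℤ G L where
  toFun g := ((ρ g).restrictScalars ℤ).restrict (hL g)
  map_one' := by ext; simp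
  map_mul' x y := by
    ext v
    exact congrArg (fun f : Module.End ℝ V => f v) (map_mul ρ x y)

/-- The homomorphism from `G` to `GL(L)`, the group of invertible `ℤ`-linear maps `L → L`. -/
def latticeHom (ρ : Representation ℝ G V) (L : Submodule ℤ V)
    (hL : ∀ (g : G), ∀ v ∈ L, ρ g v ∈ L) : G →* LinearMap.GeneralLinearGroup ℤ L :=
  MonoidHom.toHomUnits (latticeRep ρ L hL)

/-- The normalizer in `GL(L)` of (the image of) `G`. -/
def latticeNormalizer (ρ : Representation ℝ G V) (L : Submodule ℤ V)
    (hL : ∀ (g : G), ∀ v ∈ L, ρ g v ∈ L) : Subgroup (LinearMap.GeneralLinearGroup ℤ L) :=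
  Subgroup.normalizer ((latticeHom ρ L hL).range : Set (LinearMap.GeneralLinearGroup ℤ L))

end Action

end LatticeRep

/-! Let O be the ring of lattice-preserving endomorphisms commuting with G (`intCommutant`). The
centralizer of the image of G in GL(Λ) is the unit group of O. It has finite index in the
normalizer, because the quotient embeds in the automorphism group of a finite group. So the question
is when O has finitely many units (`finite_latticeNormalizer_iff`). Averaging over G shows that O
spans the commutant over ℝ, and that a rational invariant subspace has a commuting projection some
nonzero multiple of which lies in O.

If the summands are rational and pairwise non-isomorphic, Schur's lemma makes O preserve each of
them and act on it through a real division algebra. There |det| = 1 cuts out a bounded set, which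
contains only finitely many integral matrices.

Conversely, infinitely many units arise in two ways. (a) If a rational W is not stable under the
commutant, O contains N ≠ 0 with N² = 0, and the 1 + kN are units (`infinite_units_of_not_mem`). (b)
If W is minimal among nonzero rational invariant subspaces but reducible over ℝ, its commutant
contains an order whose nonzero elements are invertible, and also a nontrivial real idempotent.
Minkowski's theorem and a pigeonhole argument, as for Dirichlet's units, then apply
(`infinite_units_of_minimal`).

When O has finitely many units, (b) makes minimal rational subspaces irreducible and (a) makes them
stable. An irreducible U projects isomorphically onto a suitable one of them, so stability forces
equality and U is rational (`isRational_of_isAtom`). Isomorphic summands contradict (a). A nonzero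
irrational invariant subspace contains an irreducible one, which cannot be rational. -/

namespace LatticeRep

open Module

/-! ### Lattices, integral matrices and Minkowski's theorem -/

section Lattices

/-- Integral coordinates make the subgroup discrete: two points at distance less than 1 in the sup
norm pulled back along `j` coincide. -/
theorem exists_basis_span_int_eq {B κ : Type*} [AddCommGroup B] [Module ℝ B] [Finite κ]
    (j : B →ₗ[ℝ] κ → ℝ) (hj : Function.Injective j) (Λ : Submodule ℤ B)
    (hint : ∀ x ∈ Λ, ∀ k, ∃ z : ℤ, j x k = z)
    (hspan : Submodule.span ℝ (Λ : Set B) = ⊤) :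
    ∃ (n : ℕ) (c : Basis (Fin n) ℝ B), Submodule.span ℤ (Set.range c) = Λ := by
  have := Fintype.ofFinite κ
  let : NormedAddCommGroup B := NormedAddCommGroup.induced B (κ → ℝ) j hj
  let : NormedSpace ℝ B := NormedSpace.induced ℝ B (κ → ℝ) j
  have : FiniteDimensional ℝ B := FiniteDimensional.of_injective j hj
  have hnorm : ∀ x : B, ‖x‖ = ‖j x‖ := fun _ => rfl
  have : DiscreteTopology Λ := by
    refine DiscreteTopology.of_forall_le_dist (r := 1) one_pos ?_
    rintro ⟨x, hx⟩ ⟨y, hy⟩ hxy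
    by_contra h
    apply hxy
    have hlt : ‖j (x - y)‖ < 1 := by
      have := not_le.1 h
      rwa [Subtype.dist_eq, dist_eq_norm, hnorm] at this
    ext
    refine sub_eq_zero.1 (hj ?_)
    funext k
    obtain ⟨z, hz⟩ := hint _ (sub_mem hx hy) k
    have h1 : ‖j (x - y) k‖ < 1 := lt_of_le_of_lt (norm_le_pi_norm (j (x - y)) k) hlt
    rw [hz, Real.norm_eq_abs] at h1
    have h2 : |z| < 1 := by exact_mod_cast h1
    have h3 : z = 0 := by simpa using h2
    rw [hz, h3, map_zero]
    simp
  have : IsZLattice ℝ Λ := ⟨hspan⟩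
  have := ZLattice.module_free ℝ Λ
  have := ZLattice.module_finite ℝ Λ
  exact ⟨_, (Module.finBasis ℤ Λ).ofZLatticeBasis ℝ Λ, Basis.ofZLatticeBasis_span ℝ Λ _⟩

variable {B ι : Type*} [AddCommGroup B] [Module ℝ B] [Fintype ι] [DecidableEq ι]

theorem exists_int_matrix (c : Basis ι ℝ B) (f : B →ₗ[ℝ] B)
    (hf : ∀ x ∈ Submodule.span ℤ (Set.range c), f x ∈ Submodule.span ℤ (Set.range c)) :
    ∃ N : Matrix ι ι ℤ, LinearMap.toMatrix c c f = N.map (Int.castRingHom ℝ) := by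
  have h : ∀ i k, ∃ z : ℤ, c.repr (f (c k)) i = z := fun i k => by
    obtain ⟨z, hz⟩ := (c.mem_span_iff_repr_mem ℤ _).1 (hf _ (Submodule.subset_span ⟨k, rfl⟩)) i
    exact ⟨z, hz.symm⟩
  choose N hN using h
  exact ⟨Matrix.of N, by ext i k; simp [LinearMap.toMatrix_apply, hN]⟩

theorem toLin_int_matrix_mem (c : Basis ι ℝ B) (N : Matrix ι ι ℤ) {x : B}
    (hx : x ∈ Submodule.span ℤ (Set.range c)) :
    Matrix.toLin c c (N.map (Int.castRingHom ℝ)) x ∈ Submodule.span ℤ (Set.range c) := by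
  induction hx using Submodule.span_induction with
  | mem x hx =>
    obtain ⟨k, rfl⟩ := hx
    rw [Matrix.toLin_self]
    refine Submodule.sum_mem _ fun i _ => ?_
    have : ((N.map (Int.castRingHom ℝ)) i k) • c i = N i k • c i := by
      simp [Int.cast_smul_eq_zsmul]
    rw [this]
    exact Submodule.smul_mem _ _ (Submodule.subset_span ⟨i, rfl⟩)
  | zero => simp
  | add x y _ _ hx hy => rw [map_add]; exact add_mem hx hy
  | smul a x _ hx => rw [map_zsmul]; exact Submodule.smul_mem _ _ hx

/-- A lattice-preserving endomorphism has integral determinant and an adjugate which again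
preserves the lattice. -/
theorem exists_int_det_adjugate (c : Basis ι ℝ B) (f : B →ₗ[ℝ] B)
    (hf : ∀ x ∈ Submodule.span ℤ (Set.range c), f x ∈ Submodule.span ℤ (Set.range c)) :
    ∃ (d : ℤ) (g : B →ₗ[ℝ] B), LinearMap.det f = d ∧
      (∀ x ∈ Submodule.span ℤ (Set.range c), g x ∈ Submodule.span ℤ (Set.range c)) ∧
      ∀ x, f (g x) = (d : ℝ) • x := by
  obtain ⟨N, hN⟩ := exists_int_matrix c f hf
  refine ⟨N.det, Matrix.toLin c c (N.adjugate.map (Int.castRingHom ℝ)), ?_,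
    fun x hx => toLin_int_matrix_mem c _ hx, fun x => ?_⟩
  · rw [← LinearMap.det_toMatrix c, hN]
    exact ((Int.castRingHom ℝ).map_det N).symm
  · have h1 : f = Matrix.toLin c c (N.map (Int.castRingHom ℝ)) := by
      rw [← hN, Matrix.toLin_toMatrix]
    conv_lhs => rw [h1]
    rw [← Matrix.toLin_mul_apply, ← Matrix.map_mul, Matrix.mul_adjugate]
    have : ((N.det • (1 : Matrix ι ι ℤ)).map (Int.castRingHom ℝ)) =
        (N.det : ℝ) • (1 : Matrix ι ι ℝ) := by
      ext i k
      simp only [Matrix.map_apply, Matrix.smul_apply, Matrix.one_apply]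
      split_ifs <;> simp
    rw [this, map_smul, Matrix.toLin_one]
    simp

/-- Minkowski's theorem for the image of the lattice under `T`, which still has covolume 1 in the
coordinates of `c`. -/
theorem exists_ne_zero_abs_repr_le [Nonempty ι] (c : Basis ι ℝ B) (T : B →ₗ[ℝ] B)
    (hT : |LinearMap.det T| = 1) :
    ∃ a ∈ Submodule.span ℤ (Set.range c), a ≠ 0 ∧ ∀ i, |c.repr (T a) i| ≤ 2 := by
  have hdet : IsUnit (LinearMap.det T) := by
    refine isUnit_iff_ne_zero.2 fun h => ?_
    simp [h] at hT
  have := Module.Finite.of_basis c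
  let Te : B ≃ₗ[ℝ] B := LinearMap.equivOfIsUnitDet (f := T) hdet
  have hTe : ∀ x, Te x = T x := LinearMap.equivOfIsUnitDet_apply hdet
  let b : Basis ι ℝ (ι → ℝ) := (c.map Te).map c.equivFun
  have hb : ∀ i, b i = c.equivFun (T (c i)) := fun i => by simp [b, hTe]
  have hmat : (Matrix.of b) = (LinearMap.toMatrix c c T).transpose := by
    ext i k
    rw [Matrix.transpose_apply, LinearMap.toMatrix_apply, Matrix.of_apply, hb]
    rfl
  have hvol : MeasureTheory.volume (ZSpan.fundamentalDomain b) = 1 := by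
    rw [ZSpan.volume_fundamentalDomain, hmat, Matrix.det_transpose, LinearMap.det_toMatrix, hT]
    simp
  -- Radius 2 suffices: the sup-norm ball is a cube of volume 4^n, which exceeds 2^n times the
  -- covolume 1.
  have hball : MeasureTheory.volume (Metric.ball (0 : ι → ℝ) 2) =
      ENNReal.ofReal (4 ^ Fintype.card ι) := by
    rw [Real.volume_pi_ball _ two_pos]
    norm_num
  have : Countable (Submodule.span ℤ (Set.range b)).toAddSubgroup :=
    inferInstanceAs (Countable (Submodule.span ℤ (Set.range b)))
  obtain ⟨⟨x, hx⟩, hx0, hxs⟩ :=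
    MeasureTheory.exists_ne_zero_mem_lattice_of_measure_mul_two_pow_lt_measure
      (μ := MeasureTheory.volume) (L := (Submodule.span ℤ (Set.range b)).toAddSubgroup)
      (s := Metric.ball (0 : ι → ℝ) 2)
      (ZSpan.isAddFundamentalDomain' b MeasureTheory.volume)
      (fun x hx => by simpa using hx) (convex_ball _ _) (by
        rw [hvol, hball, one_mul, Module.finrank_fintype_fun_eq_card, ENNReal.ofReal_pow (by norm_num)]
        refine ENNReal.pow_lt_pow_left Fintype.card_ne_zero ?_
        norm_num)
  have hx' : x ∈ Submodule.span ℤ (Set.range b) := hx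
  refine ⟨Te.symm (c.equivFun.symm x), ?_, ?_, fun i => ?_⟩
  · rw [c.mem_span_iff_repr_mem ℤ]
    rw [b.mem_span_iff_repr_mem ℤ] at hx'
    intro i
    simpa [b] using hx' i
  · intro h
    apply hx0
    ext1
    exact c.equivFun.symm.map_eq_zero_iff.1 (Te.symm.map_eq_zero_iff.1 h)
  · rw [← hTe, LinearEquiv.apply_symm_apply]
    have h1 : c.repr (c.equivFun.symm x) i = x i := by
      rw [← Basis.equivFun_apply, LinearEquiv.apply_symm_apply]
    rw [h1]
    have := norm_le_pi_norm x i
    rw [mem_ball_zero_iff] at hxs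
    rw [← Real.norm_eq_abs]
    linarith

theorem det_smul_add_smul_one_sub {B : Type*} [AddCommGroup B] [Module ℝ B]
    [FiniteDimensional ℝ B] (P : End ℝ B) (hP : IsIdempotentElem P) (s t : ℝ) :
    LinearMap.det (s • P + t • (1 - P)) =
      s ^ finrank ℝ (LinearMap.range P) * t ^ finrank ℝ (LinearMap.ker P) := by
  have hc : IsCompl (LinearMap.range P) (LinearMap.ker P) :=
    LinearMap.IsIdempotentElem.isCompl hP
  let e := Submodule.prodEquivOfIsCompl _ _ hc
  have key : s • P + t • (1 - P) = e.toLinearMap ∘ₗ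
      (LinearMap.prodMap (s • (LinearMap.id : LinearMap.range P →ₗ[ℝ] LinearMap.range P))
        (t • (LinearMap.id : LinearMap.ker P →ₗ[ℝ] LinearMap.ker P))) ∘ₗ e.symm.toLinearMap := by
    rw [← LinearMap.comp_assoc, LinearEquiv.eq_comp_toLinearMap_symm]
    refine LinearMap.ext fun ⟨⟨x, hx⟩, ⟨y, hy⟩⟩ => ?_
    obtain ⟨z, rfl⟩ := hx
    have h1 : P (P z) = P z := LinearMap.congr_fun hP z
    have h2 : P y = 0 := hy
    simp [e, h1, h2]
  rw [key, LinearMap.det_conj, LinearMap.det_prodMap, LinearMap.det_smul, LinearMap.det_smul]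
  simp

end Lattices

/-- The determinant is continuous in the coordinates of `x`, hence bounded on a compact box. -/
theorem exists_abs_det_mulLeft_le {B ι : Type*} [Ring B] [Algebra ℝ B] [Fintype ι]
    (c : Basis ι ℝ B) (R : ℝ) :
    ∃ D : ℝ, ∀ x : B, (∀ i, |c.repr x i| ≤ R) → |LinearMap.det (LinearMap.mulLeft ℝ x)| ≤ D := by
  classical
  let F : (ι → ℝ) →ₗ[ℝ] Matrix ι ι ℝ :=
    (LinearMap.toMatrix c c).toLinearMap ∘ₗ (LinearMap.mul ℝ B) ∘ₗ c.equivFun.symm.toLinearMap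
  have hF : Continuous fun z => |(F z).det| :=
    (Continuous.matrix_det (LinearMap.continuous_of_finiteDimensional F)).abs
  obtain ⟨D, hD⟩ := ((isCompact_closedBall (0 : ι → ℝ) (max R 0)).image hF).bddAbove
  refine ⟨D, fun x hx => ?_⟩
  have h1 : (F (c.equivFun x)).det = LinearMap.det (LinearMap.mulLeft ℝ x) := by
    have : F (c.equivFun x) = LinearMap.toMatrix c c (LinearMap.mulLeft ℝ x) := by
      simp only [F, LinearMap.comp_apply, LinearEquiv.coe_coe, LinearEquiv.symm_apply_apply]
      rfl
    rw [this, LinearMap.det_toMatrix]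
  rw [← h1]
  refine hD ⟨_, ?_, rfl⟩
  rw [mem_closedBall_zero_iff]
  refine (pi_norm_le_iff_of_nonneg (le_max_right _ _)).2 fun i => ?_
  rw [Real.norm_eq_abs]
  exact (hx i).trans (le_max_left _ _)

theorem exists_abs_repr_apply_le {B ι : Type*} [AddCommGroup B] [Module ℝ B] [Fintype ι]
    (c : Basis ι ℝ B) (T : B →ₗ[ℝ] B) (R : ℝ) :
    ∃ D : ℝ, ∀ x : B, (∀ i, |c.repr x i| ≤ R) → ∀ i, |c.repr (T x) i| ≤ D := by
  let F : (ι → ℝ) →ₗ[ℝ] (ι → ℝ) :=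
    c.equivFun.toLinearMap ∘ₗ T ∘ₗ c.equivFun.symm.toLinearMap
  have hF : Continuous fun z => ‖F z‖ := (LinearMap.continuous_of_finiteDimensional F).norm
  obtain ⟨D, hD⟩ := ((isCompact_closedBall (0 : ι → ℝ) (max R 0)).image hF).bddAbove
  refine ⟨D, fun x hx i => ?_⟩
  have h1 : F (c.equivFun x) i = c.repr (T x) i := by simp [F]
  rw [← h1, ← Real.norm_eq_abs]
  refine (norm_le_pi_norm _ i).trans (hD ⟨_, ?_, rfl⟩)
  rw [mem_closedBall_zero_iff]
  refine (pi_norm_le_iff_of_nonneg (le_max_right _ _)).2 fun i => ?_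
  rw [Real.norm_eq_abs]
  exact (hx i).trans (le_max_left _ _)

/-! ### Units of orders in real algebras with a nontrivial idempotent -/

section Units

variable {B : Type*} [Ring B] [Algebra ℝ B] {n : ℕ} (c : Basis (Fin n) ℝ B)

/-- An order all of whose nonzero elements are invertible in the ambient real algebra contains
infinitely many elements of bounded norm, as soon as the algebra has a nontrivial idempotent. -/
theorem exists_infinite_abs_det_le
    (hunit : ∀ x ∈ Submodule.span ℤ (Set.range c), x ≠ 0 → IsUnit x)
    {e : B} (he : IsIdempotentElem e) (he0 : e ≠ 0) (he1 : e ≠ 1) :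
    ∃ (D : ℝ) (S : Set B), S.Infinite ∧ (∀ a ∈ S, a ∈ Submodule.span ℤ (Set.range c)) ∧
      (∀ a ∈ S, IsUnit a) ∧ ∀ a ∈ S, |LinearMap.det (LinearMap.mulLeft ℝ a)| ≤ D := by
  have := Module.Finite.of_basis c
  have : Nonempty (Fin n) := by
    by_contra h
    rw [not_nonempty_iff] at h
    have : Subsingleton B := c.repr.toEquiv.subsingleton
    exact he0 (Subsingleton.elim _ _)
  let P : End ℝ B := LinearMap.mulLeft ℝ e
  have hP : IsIdempotentElem P := by
    refine LinearMap.ext fun x => ?_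
    change e * (e * x) = e * x
    rw [← mul_assoc, he.eq]
  set α := finrank ℝ (LinearMap.ker P) with hα
  set β := finrank ℝ (LinearMap.range P) with hβ
  have hα0 : α ≠ 0 := by
    intro h
    have h1 := Submodule.finrank_eq_zero.1 h
    have h2 : (1 - e) ∈ LinearMap.ker P := by
      change e * (1 - e) = 0
      rw [mul_sub, mul_one, he.eq, sub_self]
    rw [h1, Submodule.mem_bot, sub_eq_zero] at h2
    exact he1 h2.symm
  -- The exponents are crossed so that the determinant ((k+1)^α)^β · ((k+1)^(-β))^α equals 1, while
  -- the e-part still grows since α ≠ 0.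
  let x : ℕ → B := fun k => ((k + 1 : ℝ) ^ α) • e + (((k + 1 : ℝ)⁻¹) ^ β) • (1 - e)
  have hdet : ∀ k, LinearMap.det (LinearMap.mulLeft ℝ (x k)) = 1 := fun k => by
    have h1 : LinearMap.mulLeft ℝ (x k) =
        ((k + 1 : ℝ) ^ α) • P + (((k + 1 : ℝ)⁻¹) ^ β) • (1 - P) := by
      refine LinearMap.ext fun y => ?_
      simp [x, P, add_mul, sub_mul]
    rw [h1, det_smul_add_smul_one_sub P hP, ← pow_mul, ← pow_mul, mul_comm α β, ← mul_pow,
      mul_inv_cancel₀ (by positivity), one_pow]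
  have hmink : ∀ k, ∃ a ∈ Submodule.span ℤ (Set.range c), a ≠ 0 ∧
      ∀ i, |c.repr (x k * a) i| ≤ 2 := fun k =>
    exists_ne_zero_abs_repr_le c (LinearMap.mulLeft ℝ (x k)) (by rw [hdet, abs_one])
  choose a haΛ ha0 ha using hmink
  obtain ⟨D, hD⟩ := exists_abs_det_mulLeft_le c 2
  obtain ⟨E, hE⟩ := exists_abs_repr_apply_le c P 2
  refine ⟨D, Set.range a, ?_, ?_, ?_, ?_⟩
  · intro hfin
    obtain ⟨⟨a₀, ha₀⟩, hinf⟩ := @Finite.exists_infinite_fiber ℕ (Set.range a) _ hfin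
      (Set.rangeFactorization a)
    have hinf' := Set.infinite_coe_iff.1 hinf
    -- If one value `a₀` occurs for infinitely many k, the bounded elements e·x_k·a₀ = (k+1)^α·e·a₀
    -- force e·a₀ = 0, although `a₀` is a unit.
    have hea : e * a₀ = 0 := by
      refine c.repr.injective (Finsupp.ext fun i => ?_)
      rw [map_zero, Finsupp.zero_apply]
      by_contra hne
      have hpos := abs_pos.2 hne
      obtain ⟨m, hm⟩ := exists_nat_gt (E / |c.repr (e * a₀) i|)
      obtain ⟨k, hk, hmk⟩ := hinf'.exists_gt m
      have hak : a k = a₀ := congrArg Subtype.val hk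
      have h1 := hE _ (ha k) i
      have h2 : P (x k * a k) = ((k + 1 : ℝ) ^ α) • (e * a₀) := by
        change e * (x k * a k) = _
        rw [← mul_assoc, hak]
        simp [x, mul_add, mul_sub, he.eq]
      rw [h2, map_smul, Finsupp.smul_apply, smul_eq_mul, abs_mul, abs_of_nonneg (by positivity)]
        at h1
      have h3 : (k + 1 : ℝ) ≤ (k + 1 : ℝ) ^ α := le_self_pow₀ (by linarith [k.cast_nonneg (α := ℝ)]) hα0
      rw [div_lt_iff₀ hpos] at hm
      have h4 : (m : ℝ) < k := by exact_mod_cast hmk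
      nlinarith
    obtain ⟨k, rfl⟩ := ha₀
    obtain ⟨u, hu⟩ := hunit _ (haΛ k) (ha0 k)
    rw [← hu, Units.mul_left_eq_zero] at hea
    exact he0 hea
  · rintro _ ⟨k, rfl⟩
    exact haΛ k
  · rintro _ ⟨k, rfl⟩
    exact hunit _ (haΛ k) (ha0 k)
  · rintro _ ⟨k, rfl⟩
    have h1 := hD _ (ha k)
    rwa [LinearMap.mulLeft_mul, LinearMap.det_comp, hdet, one_mul] at h1

/-- Among infinitely many lattice elements of bounded norm, infinitely many are congruent modulo a
common multiple M of the norms. Since M·a⁻¹ maps the lattice into itself, the quotients a⁻¹b differ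
from 1 by lattice elements. The lattice itself need not contain 1, hence the form of the conclusion.
-/
theorem exists_infinite_units
    (hmul : ∀ x ∈ Submodule.span ℤ (Set.range c), ∀ y ∈ Submodule.span ℤ (Set.range c),
      x * y ∈ Submodule.span ℤ (Set.range c))
    (hunit : ∀ x ∈ Submodule.span ℤ (Set.range c), x ≠ 0 → IsUnit x)
    {e : B} (he : IsIdempotentElem e) (he0 : e ≠ 0) (he1 : e ≠ 1) :
    {u : Bˣ | (u : B) - 1 ∈ Submodule.span ℤ (Set.range c) ∧
      ((u⁻¹ : Bˣ) : B) - 1 ∈ Submodule.span ℤ (Set.range c)}.Infinite := by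
  obtain ⟨D, S, hS, hSΛ, hSu, hSD⟩ := exists_infinite_abs_det_le c hunit he he0 he1
  have := Module.Finite.of_basis c
  set Λ := Submodule.span ℤ (Set.range c) with hΛ
  -- The factorial is divisible by every nonzero integer of absolute value at most D, so by every
  -- norm that occurs.
  let M : ℕ := (⌊D⌋₊).factorial
  have hM0 : M ≠ 0 := Nat.factorial_ne_zero _
  have : NeZero M := ⟨hM0⟩
  have hadj : ∀ u : Bˣ, (u : B) ∈ S → ∀ y ∈ Λ, (M : ℤ) • (((u⁻¹ : Bˣ) : B) * y) ∈ Λ := by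
    intro u hu y hy
    obtain ⟨d, g, hd, hg, hdg⟩ := exists_int_det_adjugate c (LinearMap.mulLeft ℝ (u : B))
      (fun x hx => hmul _ (hSΛ _ hu) x hx)
    have hd0 : d ≠ 0 := by
      rintro rfl
      have h1 : LinearMap.det (LinearMap.mulLeft ℝ ((u⁻¹ : Bˣ) : B)) *
          LinearMap.det (LinearMap.mulLeft ℝ (u : B)) = 1 := by
        rw [← LinearMap.det_comp, ← LinearMap.mulLeft_mul, Units.inv_mul, LinearMap.mulLeft_one,
          LinearMap.det_id]
      rw [hd] at h1
      simp at h1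
    have hdD : d.natAbs ≤ ⌊D⌋₊ := by
      refine Nat.le_floor ?_
      have := hSD _ hu
      rw [hd] at this
      rwa [Nat.cast_natAbs, Int.cast_abs]
    have hdvd : d ∣ (M : ℤ) := Int.natAbs_dvd.1 (Int.natCast_dvd_natCast.2
      (Nat.dvd_factorial (Int.natAbs_pos.2 hd0) hdD))
    obtain ⟨q, hq⟩ := hdvd
    have h2 : g y = d • (((u⁻¹ : Bˣ) : B) * y) := by
      have h3 : (u : B) * g y = (d : ℝ) • y := hdg y
      rw [← Units.inv_mul_cancel_left u (g y), h3, mul_smul_comm, Int.cast_smul_eq_zsmul]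
    rw [hq, mul_comm, mul_smul, ← h2]
    exact Λ.smul_mem _ (hg y hy)
  have hSi := hS.to_subtype
  -- The coordinates are already integers; the floor only reads them off before reduction modulo M.
  let φ : S → (Fin n → ZMod M) := fun a i => (⌊c.repr a i⌋ : ZMod M)
  obtain ⟨v, hv⟩ := Finite.exists_infinite_fiber φ
  have hcongr : ∀ a b : S, φ a = v → φ b = v → ∃ y ∈ Λ, (a : B) - b = (M : ℤ) • y := by
    intro a b ha hb
    have hint : ∀ s : S, ∀ i, c.repr s i = (⌊c.repr s i⌋ : ℝ) := fun s i => by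
      obtain ⟨z, hz⟩ := (c.mem_span_iff_repr_mem ℤ _).1 (hSΛ _ s.2) i
      rw [← hz]
      simp
    have hdvd : ∀ i, (M : ℤ) ∣ ⌊c.repr a i⌋ - ⌊c.repr b i⌋ := fun i => by
      rw [← ZMod.intCast_eq_intCast_iff_dvd_sub]
      exact (congrFun hb i).trans (congrFun ha i).symm
    choose q hq using hdvd
    refine ⟨∑ i, q i • c i, Submodule.sum_mem _ fun i _ =>
      Λ.smul_mem _ (Submodule.subset_span ⟨i, rfl⟩), ?_⟩
    rw [Finset.smul_sum, ← c.sum_repr a, ← c.sum_repr b, ← Finset.sum_sub_distrib]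
    refine Finset.sum_congr rfl fun i _ => ?_
    rw [← sub_smul, smul_smul, ← hq i, hint a, hint b, ← Int.cast_sub, Int.cast_smul_eq_zsmul]
    simp
  choose u hu using fun a : S => hSu a a.2
  obtain ⟨a₀⟩ : Nonempty (φ ⁻¹' {v}) := inferInstance
  have hmem : ∀ a b : S, φ a = v → φ b = v → (((u a)⁻¹ * u b : Bˣ) : B) - 1 ∈ Λ := by
    intro a b ha hb
    obtain ⟨y, hy, hab⟩ := hcongr b a hb ha
    have : (((u a)⁻¹ * u b : Bˣ) : B) - 1 = (M : ℤ) • ((((u a)⁻¹ : Bˣ) : B) * y) := by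
      rw [← mul_smul_comm, ← hab, ← hu a, ← hu b, mul_sub, Units.inv_mul, Units.val_mul]
    rw [this]
    exact hadj _ (by rw [hu]; exact a.2) y hy
  refine Set.infinite_of_injective_forall_mem (α := φ ⁻¹' {v})
    (f := fun a => (u a₀)⁻¹ * u a) (fun a b hab => ?_) (fun a => ⟨?_, ?_⟩)
  · have h1 : u a = u b := mul_left_cancel hab
    ext
    rw [← hu a, ← hu b, h1]
  · exact hmem _ _ a₀.2 a.2
  · rw [mul_inv_rev, inv_inv]
    exact hmem _ _ a.2 a₀.2

end Units

open scoped Matrix.Norms.Elementwise in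
/-- In a space of endomorphisms whose nonzero elements are invertible, only finitely many elements
of determinant `±1` preserve a given lattice. -/
theorem finite_abs_det_eq_one {E : Type*} [AddCommGroup E] [Module ℝ E] {n : ℕ}
    (c : Basis (Fin n) ℝ E) (D : Submodule ℝ (End ℝ E))
    (hD : ∀ f ∈ D, f ≠ 0 → LinearMap.det f ≠ 0) :
    {f ∈ D | (∀ x ∈ Submodule.span ℤ (Set.range c), f x ∈ Submodule.span ℤ (Set.range c)) ∧
      |LinearMap.det f| = 1}.Finite := by
  rcases Nat.eq_zero_or_pos n with rfl | hn
  · have : Subsingleton E := c.repr.toEquiv.subsingleton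
    exact Set.toFinite _
  let Φ := LinearMap.toMatrix c c
  let D' : Submodule ℝ (Matrix (Fin n) (Fin n) ℝ) := D.map Φ.toLinearMap
  have hD' : ∀ X ∈ D', X ≠ 0 → X.det ≠ 0 := by
    rintro _ ⟨f, hf, rfl⟩ h0
    change (LinearMap.toMatrix c c f).det ≠ 0
    rw [LinearMap.det_toMatrix]
    refine hD f hf fun h => h0 ?_
    rw [h, map_zero]
  have hcomp : IsCompact ((D' : Set (Matrix (Fin n) (Fin n) ℝ)) ∩ Metric.sphere 0 1) :=
    (isCompact_sphere _ _).inter_left D'.closed_of_finiteDimensional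
  have hcont : Continuous fun X : Matrix (Fin n) (Fin n) ℝ => |X.det| :=
    (Continuous.matrix_det continuous_id).abs
  -- |det| is bounded below on the compact unit sphere of the space; homogeneity of degree n > 0
  -- then bounds the norm of every element with |det| = 1.
  obtain ⟨δ, hδ, hδle⟩ : ∃ δ > 0, ∀ X ∈ (D' : Set (Matrix (Fin n) (Fin n) ℝ)) ∩ Metric.sphere 0 1,
      δ ≤ |X.det| := by
    refine hcomp.exists_forall_le' hcont.continuousOn (a := 0) fun X hX => abs_pos.2 (hD' X hX.1 ?_)
    rintro rfl
    simpa using hX.2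
  obtain ⟨K, hK⟩ : ∃ K : ℕ, ∀ X ∈ D', |X.det| = 1 → ‖X‖ ≤ K := by
    obtain ⟨K, hK⟩ := exists_nat_ge (max 1 δ⁻¹)
    refine ⟨K, fun X hX h1 => ?_⟩
    by_contra! hlt
    have hX1 : 1 < ‖X‖ := lt_of_le_of_lt ((le_max_left _ _).trans hK) hlt
    have hX0 : 0 < ‖X‖ := one_pos.trans hX1
    have h2 := hδle (‖X‖⁻¹ • X) ⟨D'.smul_mem _ hX, by
      rw [mem_sphere_zero_iff_norm, norm_smul, norm_inv, norm_norm, inv_mul_cancel₀ hX0.ne']⟩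
    rw [Matrix.det_smul, abs_mul, h1, mul_one, Fintype.card_fin, abs_pow, abs_inv, abs_norm,
      inv_pow] at h2
    have h3 : ‖X‖ ≤ ‖X‖ ^ n := le_self_pow₀ hX1.le hn.ne'
    have h4 : δ⁻¹ < ‖X‖ := lt_of_le_of_lt ((le_max_right _ _).trans hK) hlt
    have h5 : (‖X‖ ^ n)⁻¹ ≤ ‖X‖⁻¹ := inv_anti₀ hX0 h3
    have h6 : ‖X‖⁻¹ < δ := inv_lt_of_inv_lt₀ hδ h4
    linarith
  refine Set.Finite.subset (s := (fun N : Matrix (Fin n) (Fin n) ℤ =>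
      Φ.symm (N.map (Int.castRingHom ℝ))) ''
    (Set.pi Set.univ fun _ => Set.pi Set.univ fun _ => Set.Icc (-(K : ℤ)) K)) ?_ ?_
  · exact (Set.Finite.pi fun _ => Set.Finite.pi fun _ => Set.finite_Icc _ _).image _
  · rintro f ⟨hfD, hfL, hf1⟩
    obtain ⟨N, hN⟩ := exists_int_matrix c f hfL
    refine ⟨N, fun i _ k _ => ?_, ?_⟩
    · have h1 : ‖LinearMap.toMatrix c c f‖ ≤ K := hK _ ⟨f, hfD, rfl⟩
        (by rw [LinearMap.det_toMatrix, hf1])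
      have h2 := (Matrix.norm_entry_le_entrywise_sup_norm _ (i := i) (j := k)).trans h1
      rw [hN, Matrix.map_apply, Real.norm_eq_abs, eq_intCast] at h2
      rw [Set.mem_Icc, ← abs_le]
      exact_mod_cast h2
    · change Φ.symm _ = f
      rw [← hN, LinearEquiv.symm_apply_apply]

end LatticeRep

namespace LatticeRep

open Module

/-! ### Rational subspaces of a full lattice -/

section FullLattice

variable {V : Type*} [AddCommGroup V] [Module ℝ V] {L : Submodule ℤ V}

theorem IsFullLattice.span_eq_top (hL : IsFullLattice L) :
    Submodule.span ℝ (L : Set V) = ⊤ := by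
  obtain ⟨n, b, rfl⟩ := hL
  rw [Submodule.span_span_of_tower, b.span_eq]

theorem IsFullLattice.ext (hL : IsFullLattice L) {f g : End ℝ V} (h : ∀ v ∈ L, f v = g v) :
    f = g :=
  LinearMap.ext_on hL.span_eq_top h

theorem IsFullLattice.exists_extend (hL : IsFullLattice L) (F : L →ₗ[ℤ] V) :
    ∃ f : End ℝ V, ∀ v : L, f v = F v := by
  obtain ⟨n, b, rfl⟩ := hL
  let f : End ℝ V := b.constr ℝ fun i => F ⟨b i, Submodule.subset_span ⟨i, rfl⟩⟩
  refine ⟨f, ?_⟩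
  have : (f.restrictScalars ℤ) ∘ₗ (Submodule.span ℤ (Set.range b)).subtype = F := by
    refine (b.restrictScalars ℤ).ext fun i => ?_
    simp only [LinearMap.comp_apply, Submodule.subtype_apply, Basis.restrictScalars_apply,
      LinearMap.restrictScalars_apply, f, Basis.constr_basis]
    congr 1
    ext
    simp
  exact fun v => LinearMap.congr_fun this v

theorem isRational_iff [FiniteDimensional ℝ V] (U : Submodule ℝ V) :
    IsRational L U ↔ U ≤ Submodule.span ℝ ((U : Set V) ∩ L) := by
  constructor
  · rintro ⟨n, b, hb⟩ u hu
    have h1 := congrArg (Subtype.val) (b.sum_repr ⟨u, hu⟩)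
    simp only [Submodule.coe_sum, Submodule.coe_smul] at h1
    rw [← h1]
    exact Submodule.sum_mem _ fun i _ =>
      Submodule.smul_mem _ _ (Submodule.subset_span ⟨(b i).2, hb i⟩)
  · intro h
    let s : Set U := {u | (u : V) ∈ L}
    have hs : Submodule.span ℝ s = ⊤ := by
      refine Submodule.map_injective_of_injective U.injective_subtype ?_
      rw [Submodule.map_span, Submodule.map_top, Submodule.range_subtype]
      have : U.subtype '' s = (U : Set V) ∩ L := by
        ext v
        simp [s]
        tauto
      rw [this]
      exact le_antisymm (Submodule.span_le.2 Set.inter_subset_left) h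
    obtain ⟨t, b, hb⟩ : ∃ t : Set U, ∃ b : Basis t ℝ U, ∀ i, b i ∈ s := by
      obtain ⟨t, ht, hspan, hli⟩ := exists_linearIndependent ℝ s
      rw [hs] at hspan
      refine ⟨t, Basis.mk hli (by simp [hspan]), fun i => ?_⟩
      rw [Basis.mk_apply]
      exact ht i.2
    have : Fintype t := FiniteDimensional.fintypeBasisIndex b
    refine ⟨_, b.reindex (Fintype.equivFin t), fun i => ?_⟩
    rw [Basis.reindex_apply]
    exact hb _

/-- The image of the lattice spans the range and lies in the lattice. This is the main source of new
rational subspaces. -/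
theorem isRational_range [FiniteDimensional ℝ V] (hL : IsFullLattice L) {f : End ℝ V}
    (hf : ∀ v ∈ L, f v ∈ L) : IsRational L (LinearMap.range f) := by
  rw [isRational_iff, ← Submodule.map_top, ← hL.span_eq_top, Submodule.map_span]
  refine Submodule.span_mono ?_
  rintro _ ⟨v, hv, rfl⟩
  exact ⟨Submodule.subset_span ⟨v, hv, rfl⟩, hf v hv⟩

/-- A subspace meets the lattice in a direct summand of the lattice. -/
theorem exists_int_projection (hL : IsFullLattice L) (U : Submodule ℝ V) :
    ∃ q : L →ₗ[ℤ] L, (∀ v, (q v : V) ∈ U) ∧ ∀ v : L, (v : V) ∈ U → q v = v := by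
  have : Module.Finite ℤ L := by
    obtain ⟨n, b, rfl⟩ := hL
    exact Module.Finite.of_basis (b.restrictScalars ℤ)
  let N : Submodule ℤ L := (U.restrictScalars ℤ).comap L.subtype
  have hN : ∀ v : L, v ∈ N ↔ (v : V) ∈ U := fun v => Iff.rfl
  -- A real subspace containing a nonzero integer multiple of v contains v. So the quotient is
  -- torsion-free and finitely generated, hence free, and the sequence splits.
  have : IsTorsionFree ℤ (L ⧸ N) := by
    refine .of_smul_eq_zero fun z x hzx => ?_
    obtain ⟨v, rfl⟩ := N.mkQ_surjective x
    by_cases hz : z = 0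
    · exact Or.inl hz
    · right
      rw [← map_smul, Submodule.mkQ_apply, Submodule.Quotient.mk_eq_zero, hN] at hzx
      rw [Submodule.mkQ_apply, Submodule.Quotient.mk_eq_zero, hN]
      have h1 : ((z : ℝ) • (v : V)) ∈ U := by
        rw [Int.cast_smul_eq_zsmul]
        simpa using hzx
      exact (U.smul_mem_iff (by exact_mod_cast hz)).1 h1
  have : Module.Free ℤ (L ⧸ N) := Module.free_of_finite_type_torsion_free'
  obtain ⟨s, hs⟩ := Module.projective_lifting_property N.mkQ LinearMap.id N.mkQ_surjective
  refine ⟨LinearMap.id - s ∘ₗ N.mkQ, fun v => ?_, fun v hv => ?_⟩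
  · rw [← hN, ← Submodule.Quotient.mk_eq_zero, ← Submodule.mkQ_apply]
    have := LinearMap.congr_fun hs (N.mkQ v)
    simp only [LinearMap.comp_apply, LinearMap.id_apply] at this
    simp only [LinearMap.sub_apply, LinearMap.comp_apply, LinearMap.id_apply, map_sub, this,
      sub_self]
  · have : N.mkQ v = 0 := by rwa [Submodule.mkQ_apply, Submodule.Quotient.mk_eq_zero, hN]
    simp [this]

end FullLattice

/-! ### The commutant, averaging and equivariant projections -/

section Commutant

variable {V G : Type*} [AddCommGroup V] [Module ℝ V] [Group G]

/-- The algebra of endomorphisms commuting with a representation. -/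
def commutant (ρ : Representation ℝ G V) : Subalgebra ℝ (End ℝ V) :=
  Subalgebra.centralizer ℝ (Set.range ρ)

theorem mem_commutant {ρ : Representation ℝ G V} {f : End ℝ V} :
    f ∈ commutant ρ ↔ ∀ g v, f (ρ g v) = ρ g (f v) := by
  rw [commutant, Subalgebra.mem_centralizer_iff]
  constructor
  · exact fun h g v => (LinearMap.congr_fun (h _ ⟨g, rfl⟩) v).symm
  · rintro h _ ⟨g, rfl⟩
    exact LinearMap.ext fun v => (h g v).symm

/-- The ring of lattice-preserving endomorphisms commuting with a representation. -/
def intCommutant (ρ : Representation ℝ G V) (L : Submodule ℤ V) : Subring (End ℝ V) where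
  carrier := {f | f ∈ commutant ρ ∧ ∀ v ∈ L, f v ∈ L}
  mul_mem' := fun ha hb => ⟨mul_mem ha.1 hb.1, fun v hv => ha.2 _ (hb.2 v hv)⟩
  one_mem' := ⟨one_mem _, fun _ hv => hv⟩
  add_mem' := fun ha hb => ⟨add_mem ha.1 hb.1, fun v hv => add_mem (ha.2 v hv) (hb.2 v hv)⟩
  zero_mem' := ⟨zero_mem _, fun _ _ => L.zero_mem⟩
  neg_mem' := fun ha => ⟨neg_mem ha.1, fun v hv => neg_mem (ha.2 v hv)⟩

variable {ρ : Representation ℝ G V} {L : Submodule ℤ V}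

/-- The image of an invariant subspace under a commuting endomorphism. -/
def mapSubrep (W : Subrepresentation ρ) (f : End ℝ V) (hf : f ∈ commutant ρ) :
    Subrepresentation ρ where
  toSubmodule := W.toSubmodule.map f
  apply_mem_toSubmodule g := by
    rintro _ ⟨w, hw, rfl⟩
    exact ⟨ρ g w, W.apply_mem_toSubmodule g hw, mem_commutant.1 hf g w⟩

/-- The kernel of a commuting endomorphism. -/
def kerSubrep (f : End ℝ V) (hf : f ∈ commutant ρ) : Subrepresentation ρ where
  toSubmodule := LinearMap.ker f
  apply_mem_toSubmodule g v hv := by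
    rw [LinearMap.mem_ker] at hv ⊢
    rw [mem_commutant.1 hf, hv, map_zero]

section Average

variable [Fintype G]

/-- Summing the conjugates of an endomorphism under a finite group. -/
def average (ρ : Representation ℝ G V) : End ℝ V →ₗ[ℝ] End ℝ V :=
  ∑ g : G, LinearMap.mulLeft ℝ (ρ g) ∘ₗ LinearMap.mulRight ℝ (ρ g⁻¹)

theorem average_apply (f : End ℝ V) (v : V) : average ρ f v = ∑ g : G, ρ g (f (ρ g⁻¹ v)) := by
  simp [average]

theorem average_mem_commutant (f : End ℝ V) : average ρ f ∈ commutant ρ := by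
  refine mem_commutant.2 fun h v => ?_
  rw [average_apply, average_apply, map_sum]
  refine Fintype.sum_equiv (Equiv.mulLeft h⁻¹) _ _ fun g => ?_
  simp only [Equiv.coe_mulLeft, mul_inv_rev, inv_inv, ← Module.End.mul_apply, ← map_mul]
  simp

theorem average_mem_intCommutant (hL : ∀ (g : G), ∀ v ∈ L, ρ g v ∈ L) {f : End ℝ V}
    (hf : ∀ v ∈ L, f v ∈ L) : average ρ f ∈ intCommutant ρ L := by
  refine ⟨average_mem_commutant f, fun v hv => ?_⟩
  rw [average_apply]
  exact Submodule.sum_mem _ fun g _ => hL _ _ (hf _ (hL _ _ hv))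

theorem average_of_mem {f : End ℝ V} (hf : f ∈ commutant ρ) :
    average ρ f = (Fintype.card G : ℝ) • f := by
  refine LinearMap.ext fun v => ?_
  rw [average_apply, LinearMap.smul_apply]
  simp [mem_commutant.1 hf, Nat.cast_smul_eq_nsmul]

theorem average_projection (W : Subrepresentation ρ) {q : End ℝ V}
    (hq : ∀ v, q v ∈ W.toSubmodule) (hq' : ∀ v ∈ W.toSubmodule, q v = v) :
    (∀ v, average ρ q v ∈ W.toSubmodule) ∧
      ∀ v ∈ W.toSubmodule, average ρ q v = (Fintype.card G : ℝ) • v := by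
  refine ⟨fun v => ?_, fun v hv => ?_⟩
  · rw [average_apply]
    exact Submodule.sum_mem _ fun g _ => W.apply_mem_toSubmodule g (hq _)
  · rw [average_apply]
    have : ∀ g : G, ρ g (q (ρ g⁻¹ v)) = v := fun g => by
      rw [hq' _ (W.apply_mem_toSubmodule _ hv)]
      simp
    simp [this, Nat.cast_smul_eq_nsmul]

end Average

variable [Finite G]

/-- Matrix units in a lattice basis preserve the lattice, so their averages lie in the integral
commutant. Averaging acts on the commutant as multiplication by |G|. -/
theorem mem_span_intCommutant (hfull : IsFullLattice L) (hL : ∀ (g : G), ∀ v ∈ L, ρ g v ∈ L)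
    {f : End ℝ V} (hf : f ∈ commutant ρ) :
    f ∈ Submodule.span ℝ (intCommutant ρ L : Set (End ℝ V)) := by
  have := Fintype.ofFinite G
  have key : ∀ f : End ℝ V, average ρ f ∈ Submodule.span ℝ (intCommutant ρ L : Set (End ℝ V)) := by
    obtain ⟨n, b, rfl⟩ := hfull
    intro f
    rw [← Matrix.toLin_toMatrix b b f]
    generalize LinearMap.toMatrix b b f = M
    rw [Matrix.matrix_eq_sum_single M, map_sum, map_sum]
    refine Submodule.sum_mem _ fun i _ => ?_
    rw [map_sum, map_sum]
    refine Submodule.sum_mem _ fun k _ => ?_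
    have : Matrix.single i k (M i k) =
        M i k • (Matrix.single i k (1 : ℤ)).map (Int.castRingHom ℝ) := by
      rw [Matrix.map_single]
      simp
    rw [this, map_smul, map_smul]
    refine Submodule.smul_mem _ _ (Submodule.subset_span (average_mem_intCommutant hL ?_))
    exact fun v hv => toLin_int_matrix_mem b _ hv
  have h := key f
  rw [average_of_mem hf] at h
  exact (Submodule.smul_mem_iff _ (by exact_mod_cast Fintype.card_ne_zero)).1 h

/-- `p` is a commuting projection onto `W`. -/
structure IsProjOnto (W : Subrepresentation ρ) (p : End ℝ V) : Prop where
  mem_commutant : p ∈ commutant ρ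
  apply_mem : ∀ v, p v ∈ W.toSubmodule
  apply_of_mem : ∀ v ∈ W.toSubmodule, p v = v

theorem exists_isProjOnto (W : Subrepresentation ρ) : ∃ p, IsProjOnto W p := by
  have := Fintype.ofFinite G
  obtain ⟨q, hq⟩ := W.toSubmodule.subtype.exists_leftInverse_of_injective
    (LinearMap.ker_eq_bot.2 W.toSubmodule.injective_subtype)
  obtain ⟨h1, h2⟩ := average_projection W (q := W.toSubmodule.subtype ∘ₗ q)
    (fun v => (q v).2) (fun v hv => congrArg Subtype.val (LinearMap.congr_fun hq ⟨v, hv⟩))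
  refine ⟨(Fintype.card G : ℝ)⁻¹ • average ρ (W.toSubmodule.subtype ∘ₗ q),
    Subalgebra.smul_mem _ (average_mem_commutant _) _,
    fun v => Submodule.smul_mem _ _ (h1 v), fun v hv => ?_⟩
  rw [LinearMap.smul_apply, h2 v hv, inv_smul_smul₀]
  exact_mod_cast Fintype.card_ne_zero

/-- The summand projection of the lattice extends to V and, by rationality, is the identity on `W`.
Its average is |G| times the desired projection, so the denominator is |G|. -/
theorem exists_isProjOnto_of_isRational [FiniteDimensional ℝ V] (hfull : IsFullLattice L)
    (hL : ∀ (g : G), ∀ v ∈ L, ρ g v ∈ L) {W : Subrepresentation ρ}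
    (hW : IsRational L W.toSubmodule) :
    ∃ p, IsProjOnto W p ∧ ∃ n : ℕ, n ≠ 0 ∧ n • p ∈ intCommutant ρ L := by
  have := Fintype.ofFinite G
  obtain ⟨q, hqW, hq⟩ := exists_int_projection hfull W.toSubmodule
  obtain ⟨f, hf⟩ := hfull.exists_extend (L.subtype ∘ₗ q)
  have hfL : ∀ v ∈ L, f v ∈ L := fun v hv => by
    rw [hf ⟨v, hv⟩]
    exact (q _).2
  have hfW : ∀ v, f v ∈ W.toSubmodule := by
    have : Submodule.span ℝ (L : Set V) ≤ W.toSubmodule.comap f :=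
      Submodule.span_le.2 fun v hv => by
        change f v ∈ W.toSubmodule
        rw [hf ⟨v, hv⟩]
        exact hqW _
    rw [hfull.span_eq_top] at this
    exact fun v => this trivial
  have hfid : ∀ v ∈ W.toSubmodule, f v = v := by
    have h1 := (isRational_iff _).1 hW
    have h2 : Submodule.span ℝ ((W.toSubmodule : Set V) ∩ L) ≤ LinearMap.eqLocus f LinearMap.id :=
      Submodule.span_le.2 fun v hv => by
        change f v = v
        rw [hf ⟨v, hv.2⟩]
        exact congrArg Subtype.val (hq ⟨v, hv.2⟩ hv.1)
    exact fun v hv => h2 (h1 hv)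
  obtain ⟨h1, h2⟩ := average_projection W hfW hfid
  have hG : (Fintype.card G : ℝ) ≠ 0 := by exact_mod_cast Fintype.card_ne_zero
  refine ⟨(Fintype.card G : ℝ)⁻¹ • average ρ f,
    ⟨Subalgebra.smul_mem _ (average_mem_commutant _) _,
      fun v => Submodule.smul_mem _ _ (h1 v), fun v hv => ?_⟩,
    Fintype.card G, Fintype.card_ne_zero, ?_⟩
  · rw [LinearMap.smul_apply, h2 v hv, inv_smul_smul₀ hG]
  · rw [← Nat.cast_smul_eq_nsmul ℝ, smul_inv_smul₀ hG]
    exact average_mem_intCommutant hL hfL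

end Commutant

end LatticeRep

namespace LatticeRep

open Module

/-! ### Sources of infinitely many commuting lattice automorphisms -/

section InfiniteUnits

variable {V G : Type*} [AddCommGroup V] [Module ℝ V] [Group G]
  {ρ : Representation ℝ G V} {L : Submodule ℤ V}

theorem infinite_units_of_sq_eq_zero {N : End ℝ V} (hN : N ∈ intCommutant ρ L) (h0 : N ≠ 0)
    (hsq : N * N = 0) : Infinite (intCommutant ρ L)ˣ := by
  let M : intCommutant ρ L := ⟨N, hN⟩
  have hM : M * M = 0 := Subtype.ext hsq
  have hmul : ∀ k l : ℤ, (1 + k • M) * (1 + l • M) = 1 + (k + l) • M := fun k l => by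
    simp only [mul_add, add_mul, one_mul, mul_one, smul_mul_smul_comm, hM, smul_zero, add_smul]
    abel
  refine Infinite.of_injective (β := ℤ)
    (fun k => (⟨1 + k • M, 1 + (-k) • M, by rw [hmul]; simp, by rw [hmul]; simp⟩ :
      (intCommutant ρ L)ˣ)) fun k l hkl => ?_
  have h1 : (1 + k • M : intCommutant ρ L) = 1 + l • M := congrArg Units.val hkl
  have h2 : k • N = l • N := congrArg Subtype.val (add_left_cancel h1)
  rw [← sub_eq_zero, ← sub_smul, ← Int.cast_smul_eq_zsmul ℝ, smul_eq_zero] at h2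
  rcases h2 with h2 | h2
  · exact sub_eq_zero.1 (by exact_mod_cast h2)
  · exact absurd h2 h0

theorem coe_mem_commutant {W : Subrepresentation ρ} {p : End ℝ V} (hp : IsProjOnto W p)
    {f : End ℝ W.toSubmodule} (hf : f ∈ commutant W.toRepresentation) :
    W.toSubmodule.subtype ∘ₗ f ∘ₗ p.codRestrict _ hp.apply_mem ∈ commutant ρ := by
  refine mem_commutant.2 fun g v => ?_
  have h1 : p.codRestrict _ hp.apply_mem (ρ g v) =
      W.toRepresentation g (p.codRestrict _ hp.apply_mem v) :=
    Subtype.ext (mem_commutant.1 hp.mem_commutant g v)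
  simp only [LinearMap.comp_apply, h1, mem_commutant.1 hf]
  rfl

theorem restrict_mem_commutant {W : Subrepresentation ρ} {p : End ℝ V} (hp : IsProjOnto W p)
    {f : End ℝ V} (hf : f ∈ commutant ρ) :
    p.codRestrict _ hp.apply_mem ∘ₗ f ∘ₗ W.toSubmodule.subtype ∈ commutant W.toRepresentation := by
  refine mem_commutant.2 fun g v => Subtype.ext ?_
  have h1 : ((W.toRepresentation g v : W.toSubmodule) : V) = ρ g v := rfl
  simp only [LinearMap.comp_apply, LinearMap.codRestrict_apply, Submodule.subtype_apply, h1,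
    mem_commutant.1 hf, mem_commutant.1 hp.mem_commutant]
  rfl

theorem isUnit_commutant_of_bijective {f : commutant ρ} (hf : Function.Bijective (f : End ℝ V)) :
    IsUnit f := by
  let e := LinearEquiv.ofBijective (f : End ℝ V) hf
  have he : ∀ v, e v = (f : End ℝ V) v := fun v => rfl
  have hmem : (e.symm : End ℝ V) ∈ commutant ρ := mem_commutant.2 fun g v => by
    apply e.injective
    simp only [LinearEquiv.coe_coe, LinearEquiv.apply_symm_apply]
    rw [he, mem_commutant.1 f.2, ← he, LinearEquiv.apply_symm_apply]
  exact ⟨⟨f, ⟨_, hmem⟩, Subtype.ext (LinearMap.ext fun v => e.apply_symm_apply v),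
    Subtype.ext (LinearMap.ext fun v => e.symm_apply_apply v)⟩, rfl⟩

/-- An order in a real algebra embedded into the commutant yields infinitely many units if all its
nonzero elements are invertible and the algebra has a nontrivial idempotent. -/
theorem infinite_units_of_embedding {Ct : Type*} [Ring Ct] [Algebra ℝ Ct]
    (hfull : IsFullLattice L) (Θ : Ct →ₗ[ℝ] End ℝ V) (hΘinj : Function.Injective Θ)
    (hΘmul : ∀ f g, Θ (f * g) = Θ f * Θ g) (hΘC : ∀ f, Θ f ∈ commutant ρ)
    (hspan : Submodule.span ℝ {f | ∀ v ∈ L, Θ f v ∈ L} = ⊤)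
    (hunit : ∀ f, (∀ v ∈ L, Θ f v ∈ L) → f ≠ 0 → IsUnit f)
    {e : Ct} (he : IsIdempotentElem e) (he0 : e ≠ 0) (he1 : e ≠ 1) :
    Infinite (intCommutant ρ L)ˣ := by
  let Λ : Submodule ℤ Ct :=
    { carrier := {f | ∀ v ∈ L, Θ f v ∈ L}
      add_mem' := fun ha hb v hv => by
        rw [map_add]
        exact add_mem (ha v hv) (hb v hv)
      zero_mem' := fun v _ => by rw [map_zero]; exact L.zero_mem
      smul_mem' := fun z f hf v hv => by
        rw [map_zsmul]
        exact L.smul_mem z (hf v hv) }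
  obtain ⟨m, c, hc⟩ : ∃ (m : ℕ) (c : Basis (Fin m) ℝ Ct), Submodule.span ℤ (Set.range c) = Λ := by
    obtain ⟨n, b, rfl⟩ := id hfull
    let j : Ct →ₗ[ℝ] (Fin n × Fin n) → ℝ :=
      LinearMap.pi fun ik => Matrix.entryLinearMap ℝ ℝ ik.1 ik.2 ∘ₗ
        (LinearMap.toMatrix b b).toLinearMap ∘ₗ Θ
    have hj : ∀ f i k, j f (i, k) = LinearMap.toMatrix b b (Θ f) i k := fun f i k => rfl
    refine exists_basis_span_int_eq j (fun f g hfg => ?_) Λ (fun f hf ik => ?_) hspan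
    · refine hΘinj ((LinearMap.toMatrix b b).injective ?_)
      ext i k
      rw [← hj, ← hj, hfg]
    · obtain ⟨M, hM⟩ := exists_int_matrix b (Θ f) hf
      exact ⟨M ik.1 ik.2, by rw [hj, hM]; simp⟩
  have hmul : ∀ x ∈ Λ, ∀ y ∈ Λ, x * y ∈ Λ := fun x hx y hy v hv => by
    rw [hΘmul]
    exact hx _ (hy v hv)
  have hinf := exists_infinite_units c (by rwa [hc]) (by rw [hc]; exact hunit) he he0 he1
  rw [hc] at hinf
  have hinf' := hinf.to_subtype
  -- `Θ` need not send 1 to 1: for extension by zero it gives the projection. A unit u is therefore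
  -- transported as 1 + Θ(u − 1), which extends it by the identity on the complement.
  have hmem : ∀ f ∈ Λ, 1 + Θ f ∈ intCommutant ρ L := fun f hf =>
    add_mem (one_mem _) ⟨hΘC f, hf⟩
  have hinv : ∀ f g : Ct, f * g = 1 → (1 + Θ (f - 1)) * (1 + Θ (g - 1)) = 1 := fun f g hfg => by
    have h1 : (f - 1) * (g - 1) + (f - 1) + (g - 1) = 0 := by
      rw [← sub_eq_zero.2 hfg]
      noncomm_ring
    have h2 := congrArg Θ h1
    rw [map_add, map_add, hΘmul, map_zero] at h2
    have h3 : (1 + Θ (f - 1)) * (1 + Θ (g - 1)) =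
        1 + (Θ (f - 1) * Θ (g - 1) + Θ (f - 1) + Θ (g - 1)) := by noncomm_ring
    rw [h3, h2, add_zero]
  refine Infinite.of_injective
    (β := {u : Ctˣ | (u : Ct) - 1 ∈ Λ ∧ ((u⁻¹ : Ctˣ) : Ct) - 1 ∈ Λ})
    (fun u => (⟨⟨_, hmem _ u.2.1⟩, ⟨_, hmem _ u.2.2⟩,
      Subtype.ext (hinv _ _ u.1.mul_inv), Subtype.ext (hinv _ _ u.1.inv_mul)⟩ :
      (intCommutant ρ L)ˣ)) fun u v huv => ?_
  have h1 : (1 : End ℝ V) + Θ (u.1 - 1) = 1 + Θ (v.1 - 1) :=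
    congrArg (fun x : (intCommutant ρ L)ˣ => ((x : intCommutant ρ L) : End ℝ V)) huv
  exact Subtype.ext (Units.ext (sub_left_injective (hΘinj (add_left_cancel h1))))

theorem wellFoundedLT_subrepresentation [FiniteDimensional ℝ V] :
    WellFoundedLT (Subrepresentation ρ) :=
  StrictMono.wellFoundedLT (f := fun X : Subrepresentation ρ => X.toSubmodule)
    fun _ _ h => lt_of_le_not_ge h.le h.not_ge

/-- Extension of an endomorphism of an invariant subspace by zero along a projection. -/
def extendByZero {W : Subrepresentation ρ} {p : End ℝ V} (hp : IsProjOnto W p) :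
    commutant W.toRepresentation →ₗ[ℝ] End ℝ V where
  toFun f := W.toSubmodule.subtype ∘ₗ (f : End ℝ W.toSubmodule) ∘ₗ p.codRestrict _ hp.apply_mem
  map_add' f g := by ext; simp
  map_smul' c f := by ext; simp

theorem extendByZero_apply {W : Subrepresentation ρ} {p : End ℝ V} (hp : IsProjOnto W p)
    (f : commutant W.toRepresentation) (v : V) :
    extendByZero hp f v = ((f : End ℝ W.toSubmodule) (p.codRestrict _ hp.apply_mem v) : V) := rfl

theorem codRestrict_coe {W : Subrepresentation ρ} {p : End ℝ V} (hp : IsProjOnto W p)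
    (w : W.toSubmodule) : p.codRestrict _ hp.apply_mem (w : V) = w :=
  Subtype.ext (hp.apply_of_mem _ w.2)

theorem extendByZero_injective {W : Subrepresentation ρ} {p : End ℝ V} (hp : IsProjOnto W p) :
    Function.Injective (extendByZero hp) := fun f g hfg => by
  refine Subtype.ext (LinearMap.ext fun w => Subtype.ext ?_)
  have := LinearMap.congr_fun hfg w
  rwa [extendByZero_apply, extendByZero_apply, codRestrict_coe hp] at this

theorem extendByZero_mul {W : Subrepresentation ρ} {p : End ℝ V} (hp : IsProjOnto W p)
    (f g : commutant W.toRepresentation) :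
    extendByZero hp (f * g) = extendByZero hp f * extendByZero hp g := by
  refine LinearMap.ext fun v => ?_
  rw [Module.End.mul_apply, extendByZero_apply, extendByZero_apply hp f, extendByZero_apply hp g,
    codRestrict_coe hp]
  rfl

/-- On a minimal rational invariant subspace, nonzero lattice-preserving elements of the commutant
are invertible. -/
theorem isUnit_of_minimal [FiniteDimensional ℝ V] (hfull : IsFullLattice L)
    {W : Subrepresentation ρ}
    (hmin : ∀ X : Subrepresentation ρ, IsRational L X.toSubmodule → X ≠ ⊥ → X ≤ W → X = W)
    {p : End ℝ V} (hp : IsProjOnto W p) {x : commutant W.toRepresentation}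
    (hx : ∀ v ∈ L, extendByZero hp x v ∈ L) (hx0 : x ≠ 0) : IsUnit x := by
  have h1 : mapSubrep ⊤ (extendByZero hp x) (coe_mem_commutant hp x.2) = W := by
    refine hmin _ ?_ ?_ ?_
    · change IsRational L (Submodule.map (extendByZero hp x) ⊤)
      rw [Submodule.map_top]
      exact isRational_range hfull hx
    · intro h
      have h2 : Submodule.map (extendByZero hp x) ⊤ = ⊥ :=
        congrArg Subrepresentation.toSubmodule h
      rw [Submodule.map_top, LinearMap.range_eq_bot] at h2
      exact hx0 (extendByZero_injective hp (h2.trans (map_zero _).symm))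
    · rintro _ ⟨v, _, rfl⟩
      rw [extendByZero_apply]
      exact Subtype.prop _
  have hsurj : Function.Surjective (x : End ℝ W.toSubmodule) := fun w => by
    have h2 : (w : V) ∈ mapSubrep ⊤ (extendByZero hp x) (coe_mem_commutant hp x.2) := by
      rw [h1]
      exact w.2
    obtain ⟨v, _, hv⟩ := h2
    exact ⟨p.codRestrict _ hp.apply_mem v, Subtype.ext hv⟩
  exact isUnit_commutant_of_bijective ⟨LinearMap.injective_iff_surjective.2 hsurj, hsurj⟩

/-- The projection onto a proper nonzero invariant subspace is a nontrivial idempotent. -/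
theorem exists_isIdempotentElem {W X : Subrepresentation ρ} {p q : End ℝ V} (hp : IsProjOnto W p)
    (hq : IsProjOnto X q) (hX : X ≠ ⊥) (hXW : X < W) :
    ∃ e : commutant W.toRepresentation, IsIdempotentElem e ∧ e ≠ 0 ∧ e ≠ 1 := by
  let e : commutant W.toRepresentation :=
    ⟨p.codRestrict _ hp.apply_mem ∘ₗ q ∘ₗ W.toSubmodule.subtype,
      restrict_mem_commutant hp hq.mem_commutant⟩
  have he_apply : ∀ w : W.toSubmodule, (((e : End ℝ W.toSubmodule) w : W.toSubmodule) : V) = q w :=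
    fun w => hp.apply_of_mem _ (hXW.le (hq.apply_mem _))
  have he : IsIdempotentElem e := by
    refine Subtype.ext (LinearMap.ext fun w => Subtype.ext ?_)
    have h1 : (((e * e : commutant W.toRepresentation) : End ℝ W.toSubmodule) w) =
      (e : End ℝ W.toSubmodule) ((e : End ℝ W.toSubmodule) w) := rfl
    rw [h1, he_apply, he_apply, hq.apply_of_mem _ (hq.apply_mem _)]
  have he0 : e ≠ 0 := fun h => hX (by
    refine le_bot_iff.1 fun x hx => ?_
    have h1 := he_apply ⟨x, hXW.le hx⟩
    rw [h, hq.apply_of_mem x hx] at h1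
    exact h1.symm)
  have he1 : e ≠ 1 := fun h => hXW.not_ge fun w hw => by
    have h1 := he_apply ⟨w, hw⟩
    rw [h] at h1
    have h2 : w = q w := h1
    rw [h2]
    exact hq.apply_mem w
  exact ⟨e, he, he0, he1⟩

variable [Finite G]

/-- A rational invariant subspace which is not stable under some commuting endomorphism gives rise
to infinitely many commuting lattice automorphisms. -/
theorem infinite_units_of_not_mem [FiniteDimensional ℝ V] (hfull : IsFullLattice L)
    (hL : ∀ (g : G), ∀ v ∈ L, ρ g v ∈ L) {W : Subrepresentation ρ}
    (hW : IsRational L W.toSubmodule) {x : End ℝ V} (hx : x ∈ commutant ρ) {w : V}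
    (hw : w ∈ W.toSubmodule) (hxw : x w ∉ W.toSubmodule) :
    Infinite (intCommutant ρ L)ˣ := by
  obtain ⟨p, hp, n, hn, hnp⟩ := exists_isProjOnto_of_isRational hfull hL hW
  have hpp : p * p = p := LinearMap.ext fun v => hp.apply_of_mem _ (hp.apply_mem v)
  have hpx : (1 - p) * x * p ≠ 0 := fun h => by
    have h1 := LinearMap.congr_fun h w
    simp only [Module.End.mul_apply, hp.apply_of_mem w hw, LinearMap.sub_apply,
      Module.End.one_apply, LinearMap.zero_apply, sub_eq_zero] at h1
    exact hxw (h1 ▸ hp.apply_mem _)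
  -- The condition is linear in the middle factor and the integral commutant spans the commutant, so
  -- `x` can be replaced by an integral element.
  obtain ⟨o, ho, hpo⟩ : ∃ o ∈ intCommutant ρ L, (1 - p) * o * p ≠ 0 := by
    by_contra! hall
    have h1 : Submodule.span ℝ (intCommutant ρ L : Set (End ℝ V)) ≤
        LinearMap.ker (LinearMap.mulRight ℝ p ∘ₗ LinearMap.mulLeft ℝ (1 - p)) :=
      Submodule.span_le.2 fun o ho => hall o ho
    exact hpx (h1 (mem_span_intCommutant hfull hL hx))
  have hnp' : n • (1 - p) ∈ intCommutant ρ L := by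
    rw [smul_sub]
    exact sub_mem (nsmul_mem (one_mem _) n) hnp
  have heq : (n • (1 - p)) * o * (n • p) = (n * n) • ((1 - p) * o * p) := by
    rw [smul_mul_assoc, smul_mul_assoc, mul_smul_comm, smul_smul]
  refine infinite_units_of_sq_eq_zero (mul_mem (mul_mem hnp' ho) hnp) ?_ ?_
  · rw [heq, ← Nat.cast_smul_eq_nsmul ℝ]
    exact smul_ne_zero (by exact_mod_cast mul_ne_zero hn hn) hpo
  · rw [heq, smul_mul_smul_comm]
    have : (1 - p) * o * p * ((1 - p) * o * p) = (1 - p) * o * (p * (1 - p)) * o * p := by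
      noncomm_ring
    rw [this, mul_sub, mul_one, hpp]
    simp

/-- The lattice-preserving elements span the commutant of a rational invariant subspace. -/
theorem span_extendByZero_eq_top (hfull : IsFullLattice L)
    (hL : ∀ (g : G), ∀ v ∈ L, ρ g v ∈ L) {W : Subrepresentation ρ} {p : End ℝ V}
    (hp : IsProjOnto W p) {N : ℕ} (hN : N ≠ 0) (hNp : N • p ∈ intCommutant ρ L) :
    Submodule.span ℝ {f | ∀ v ∈ L, extendByZero hp f v ∈ L} = ⊤ := by
  have h1 : ∀ y ∈ Submodule.span ℝ (intCommutant ρ L : Set (End ℝ V)),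
      ∃ z ∈ Submodule.span ℝ {f | ∀ v ∈ L, extendByZero hp f v ∈ L},
        (z : End ℝ W.toSubmodule) =
          p.codRestrict _ hp.apply_mem ∘ₗ y ∘ₗ W.toSubmodule.subtype := by
    intro y hy
    induction hy using Submodule.span_induction with
    | mem o ho =>
      let z : commutant W.toRepresentation :=
        ⟨p.codRestrict _ hp.apply_mem ∘ₗ o ∘ₗ W.toSubmodule.subtype,
          restrict_mem_commutant hp ho.1⟩
      refine ⟨z, ?_, rfl⟩
      have hz : ((N * N : ℕ) : ℝ) • z ∈ {f | ∀ v ∈ L, extendByZero hp f v ∈ L} := by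
        intro v hv
        have h2 : extendByZero hp z = p * o * p := rfl
        have h3 : extendByZero hp (((N * N : ℕ) : ℝ) • z) = (N • p) * o * (N • p) := by
          rw [smul_mul_assoc, smul_mul_assoc, mul_smul_comm, smul_smul, map_smul, h2,
            Nat.cast_smul_eq_nsmul]
        rw [h3]
        exact (mul_mem (mul_mem hNp ho) hNp).2 v hv
      refine (Submodule.smul_mem_iff _ ?_).1 (Submodule.subset_span hz)
      exact_mod_cast mul_ne_zero hN hN
    | zero => exact ⟨0, zero_mem _, by simp⟩
    | add x y _ _ hx hy =>
      obtain ⟨a, ha, hax⟩ := hx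
      obtain ⟨b, hb, hby⟩ := hy
      exact ⟨a + b, add_mem ha hb, by simp [hax, hby, LinearMap.add_comp, LinearMap.comp_add]⟩
    | smul r x _ hx =>
      obtain ⟨a, ha, hax⟩ := hx
      exact ⟨r • a, Submodule.smul_mem _ _ ha,
        by simp [hax, LinearMap.smul_comp, LinearMap.comp_smul]⟩
  refine eq_top_iff.2 fun x _ => ?_
  obtain ⟨z, hz, hzx⟩ := h1 _ (mem_span_intCommutant hfull hL (coe_mem_commutant hp x.2))
  have : z = x := Subtype.ext (by
    rw [hzx]
    refine LinearMap.ext fun w => ?_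
    simp only [LinearMap.comp_apply, Submodule.subtype_apply, codRestrict_coe hp])
  rwa [← this]

/-- A minimal nonzero rational invariant subspace which is reducible over `ℝ` gives rise to
infinitely many commuting lattice automorphisms. -/
theorem infinite_units_of_minimal [FiniteDimensional ℝ V] (hfull : IsFullLattice L)
    (hL : ∀ (g : G), ∀ v ∈ L, ρ g v ∈ L) {W : Subrepresentation ρ}
    (hW : IsRational L W.toSubmodule)
    (hmin : ∀ X : Subrepresentation ρ, IsRational L X.toSubmodule → X ≠ ⊥ → X ≤ W → X = W)
    {X : Subrepresentation ρ} (hX : X ≠ ⊥) (hXW : X < W) : Infinite (intCommutant ρ L)ˣ := by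
  obtain ⟨p, hp, N, hN, hNp⟩ := exists_isProjOnto_of_isRational hfull hL hW
  obtain ⟨q, hq⟩ := exists_isProjOnto X
  obtain ⟨e, he, he0, he1⟩ := exists_isIdempotentElem hp hq hX hXW
  have h1 := span_extendByZero_eq_top hfull hL hp hN hNp
  have h2 : ∀ f, extendByZero hp f ∈ commutant ρ := fun f => coe_mem_commutant hp f.2
  have h3 : ∀ f, (∀ v ∈ L, extendByZero hp f v ∈ L) → f ≠ 0 → IsUnit f :=
    fun x hx hx0 => isUnit_of_minimal hfull hmin hp hx hx0
  have h4 := infinite_units_of_embedding (ρ := ρ) (Ct := commutant W.toRepresentation) hfull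
    (extendByZero hp)
  exact h4 (extendByZero_injective hp) (extendByZero_mul hp) h2 h1 h3 (e := e) he he0 he1

/-- If there are finitely many commuting lattice automorphisms, irreducible invariant subspaces
are rational. -/
theorem isRational_of_isAtom [FiniteDimensional ℝ V] (hfull : IsFullLattice L)
    (hL : ∀ (g : G), ∀ v ∈ L, ρ g v ∈ L) (hfin : Finite (intCommutant ρ L)ˣ)
    {U : Subrepresentation ρ} (hU : IsAtom U) : IsRational L U.toSubmodule := by
  have := wellFoundedLT_subrepresentation (ρ := ρ)
  have htop : IsRational L (⊤ : Subrepresentation ρ).toSubmodule := by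
    have := isRational_range hfull (f := 1) (fun v hv => hv)
    rwa [Module.End.one_eq_id, LinearMap.range_id] at this
  -- `W` is the rational hull of `U`, and `W₁` a minimal nonzero rational piece of it, irreducible
  -- over ℝ by case (b).
  obtain ⟨W, ⟨hUW, hW⟩, hWmin⟩ := exists_minimal_of_wellFoundedLT
    (fun W : Subrepresentation ρ => U ≤ W ∧ IsRational L W.toSubmodule) ⟨⊤, le_top, htop⟩
  obtain ⟨W₁, ⟨hW₁W, hW₁, hW₁0⟩, hW₁min⟩ := exists_minimal_of_wellFoundedLT
    (fun X : Subrepresentation ρ => X ≤ W ∧ IsRational L X.toSubmodule ∧ X ≠ ⊥)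
    ⟨W, le_rfl, hW, fun h => hU.1 (le_bot_iff.1 (h ▸ hUW))⟩
  have hatom : IsAtom W₁ := ⟨hW₁0, fun X hX => by
    by_contra hX0
    refine not_finite_iff_infinite.2 (infinite_units_of_minimal hfull hL hW₁ ?_ hX0 hX) hfin
    exact fun Y hY hY0 hYW => le_antisymm hYW (hW₁min ⟨hYW.trans hW₁W, hY, hY0⟩ hYW)⟩
  by_cases hUW₁ : U ≤ W₁
  · rcases hatom.le_iff.1 hUW₁ with h | h
    · exact absurd h hU.1
    · rwa [h]
  exfalso
  obtain ⟨p, hp, n, hn, hnp⟩ := exists_isProjOnto_of_isRational hfull hL hW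
  obtain ⟨p₁, hp₁, n₁, hn₁, hnp₁⟩ := exists_isProjOnto_of_isRational hfull hL hW₁
  -- Otherwise the range of p − p₁p is a rational subspace of `W` containing `U`, hence all of `W`;
  -- but p₁ kills it while fixing `W₁ ≤ W`.
  have hker : ¬ U ≤ kerSubrep p₁ hp₁.mem_commutant := fun hUker => by
    have hr : p - p₁ * p ∈ commutant ρ :=
      sub_mem hp.mem_commutant (mul_mem hp₁.mem_commutant hp.mem_commutant)
    have hrO : (n₁ * n) • (p - p₁ * p) ∈ intCommutant ρ L := by
      have : (n₁ * n) • (p - p₁ * p) = n₁ • (n • p) - (n₁ • p₁) * (n • p) := by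
        rw [smul_sub, mul_smul, smul_mul_smul_comm]
      rw [this]
      exact sub_mem (nsmul_mem hnp _) (mul_mem hnp₁ hnp)
    have hnn : ((n₁ * n : ℕ) : ℝ) ≠ 0 := by exact_mod_cast mul_ne_zero hn₁ hn
    let W₂ := mapSubrep ⊤ ((n₁ * n) • (p - p₁ * p)) hrO.1
    have hW₂ : W ≤ W₂ := by
      refine hWmin ⟨fun u hu => ?_, ?_⟩ ?_
      · refine ⟨((n₁ * n : ℕ) : ℝ)⁻¹ • u, trivial, ?_⟩
        have h1 : p₁ u = 0 := hUker hu
        rw [map_smul, ← Nat.cast_smul_eq_nsmul ℝ, LinearMap.smul_apply, inv_smul_smul₀ hnn,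
          LinearMap.sub_apply, Module.End.mul_apply, hp.apply_of_mem u (hUW hu), h1, sub_zero]
      · change IsRational L (Submodule.map _ ⊤)
        rw [Submodule.map_top]
        exact isRational_range hfull hrO.2
      · rintro _ ⟨v, _, rfl⟩
        rw [← Nat.cast_smul_eq_nsmul ℝ]
        exact W.toSubmodule.smul_mem _
          (sub_mem (hp.apply_mem v) (hW₁W (hp₁.apply_mem _)))
    refine hW₁0 (le_bot_iff.1 fun w hw => ?_)
    obtain ⟨v, _, rfl⟩ := hW₂ (hW₁W hw)
    rw [← Nat.cast_smul_eq_nsmul ℝ] at hw ⊢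
    have h1 := hp₁.apply_of_mem _ hw
    rw [LinearMap.smul_apply, map_smul, LinearMap.sub_apply, map_sub, Module.End.mul_apply,
      hp₁.apply_of_mem _ (hp₁.apply_mem _), sub_self, smul_zero] at h1
    exact h1.symm
  let φ : U.toSubmodule →ₗ[ℝ] W₁.toSubmodule :=
    p₁.codRestrict _ hp₁.apply_mem ∘ₗ U.toSubmodule.subtype
  have hφ : ∀ u, (φ u : V) = p₁ u := fun u => rfl
  have hbot : U ⊓ kerSubrep p₁ hp₁.mem_commutant = ⊥ :=
    (hU.le_iff.1 inf_le_left).resolve_right fun h => hker (inf_eq_left.1 h)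
  have hmap : mapSubrep U p₁ hp₁.mem_commutant = W₁ := by
    refine (hatom.le_iff.1 ?_).resolve_left fun h => hker fun u hu => ?_
    · rintro _ ⟨u, _, rfl⟩
      exact hp₁.apply_mem u
    · have : p₁ u ∈ mapSubrep U p₁ hp₁.mem_commutant := ⟨u, hu, rfl⟩
      rw [h] at this
      exact this
  have hφbij : Function.Bijective φ := by
    constructor
    · rw [← LinearMap.ker_eq_bot, LinearMap.ker_eq_bot']
      intro u hu
      have : (u : V) ∈ U ⊓ kerSubrep p₁ hp₁.mem_commutant := ⟨u.2, congrArg Subtype.val hu⟩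
      rw [hbot] at this
      exact Subtype.ext this
    · intro w
      have hw : (w : V) ∈ mapSubrep U p₁ hp₁.mem_commutant := by
        rw [hmap]
        exact w.2
      obtain ⟨u, hu, huw⟩ := hw
      exact ⟨⟨u, hu⟩, Subtype.ext huw⟩
  let ε := LinearEquiv.ofBijective φ hφbij
  have hε : ∀ u, ε u = φ u := fun u => rfl
  -- By irreducibility p₁ maps `U` isomorphically onto `W₁`. The inverse, precomposed with p₁,
  -- commutes with G and carries `W₁` onto `U`, which is not inside `W₁`: case (a).
  let x : End ℝ V := U.toSubmodule.subtype ∘ₗ ε.symm.toLinearMap ∘ₗ p₁.codRestrict _ hp₁.apply_mem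
  have hxε : ∀ u : U.toSubmodule, x (φ u) = u := fun u => by
    have h1 : p₁.codRestrict _ hp₁.apply_mem (φ u : V) = ε u :=
      Subtype.ext (hp₁.apply_of_mem _ (φ u).2)
    simp only [x, LinearMap.comp_apply, h1, LinearEquiv.coe_coe, LinearEquiv.symm_apply_apply,
      Submodule.subtype_apply]
  have hx : x ∈ commutant ρ := mem_commutant.2 fun g v => by
    let u := ε.symm (p₁.codRestrict _ hp₁.apply_mem v)
    have h1 : x v = u := rfl
    have h2 : ε.symm (p₁.codRestrict _ hp₁.apply_mem (ρ g v)) =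
        ⟨ρ g u, U.apply_mem_toSubmodule g u.2⟩ := by
      rw [LinearEquiv.symm_apply_eq]
      refine Subtype.ext ?_
      have h3 : p₁ u = p₁ v := congrArg Subtype.val (ε.apply_symm_apply _)
      rw [hε, hφ, LinearMap.codRestrict_apply, mem_commutant.1 hp₁.mem_commutant,
        mem_commutant.1 hp₁.mem_commutant, h3]
    rw [h1]
    exact congrArg Subtype.val h2
  obtain ⟨u, hu, huW⟩ := SetLike.not_le_iff_exists.1 hUW₁
  refine not_finite_iff_infinite.2 (infinite_units_of_not_mem hfull hL hW₁ hx (φ ⟨u, hu⟩).2 ?_) hfin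
  rw [hxε]
  exact huW

end InfiniteUnits

end LatticeRep

namespace LatticeRep

open Module

/-! ### From the normalizer to units of the integral commutant -/

section Normalizer

variable {V G : Type*} [AddCommGroup V] [Module ℝ V] [Group G]
  {ρ : Representation ℝ G V} {L : Submodule ℤ V}

/-- Restriction of a lattice-preserving endomorphism to the lattice. -/
def restrictHom (ρ : Representation ℝ G V) (L : Submodule ℤ V) :
    intCommutant ρ L →* End ℤ L where
  toFun f := ((f : End ℝ V).restrictScalars ℤ).restrict f.2.2
  map_one' := by ext; simp
  map_mul' _ _ := rfl

theorem restrictHom_injective (hfull : IsFullLattice L) :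
    Function.Injective (restrictHom ρ L) := fun _ _ hfg =>
  Subtype.ext (hfull.ext fun v hv => congrArg Subtype.val (LinearMap.congr_fun hfg ⟨v, hv⟩))

theorem latticeHom_apply (hL : ∀ (g : G), ∀ v ∈ L, ρ g v ∈ L) (g : G) (v : L) :
    (((latticeHom ρ L hL g : LinearMap.GeneralLinearGroup ℤ L) : End ℤ L) v : V) = ρ g v := rfl

/-- A lattice automorphism extends uniquely to V, and commutation with G is tested on the lattice.
The inverse is extended separately, to obtain a unit. -/
theorem centralizer_eq_range (hfull : IsFullLattice L) (hL : ∀ (g : G), ∀ v ∈ L, ρ g v ∈ L) :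
    Subgroup.centralizer ((latticeHom ρ L hL).range : Set (LinearMap.GeneralLinearGroup ℤ L)) =
      (Units.map (restrictHom ρ L)).range := by
  ext γ
  rw [Subgroup.mem_centralizer_iff]
  constructor
  · intro hγ
    have hcomm : ∀ g (v : L), (latticeHom ρ L hL g : End ℤ L) ((γ : End ℤ L) v) =
        (γ : End ℤ L) ((latticeHom ρ L hL g : End ℤ L) v) := fun g v =>
      LinearMap.congr_fun (congrArg Units.val (hγ _ ⟨g, rfl⟩)) v
    have hcomm' : ∀ g (v : L), (latticeHom ρ L hL g : End ℤ L) (((γ⁻¹ : _ˣ) : End ℤ L) v) =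
        ((γ⁻¹ : _ˣ) : End ℤ L) ((latticeHom ρ L hL g : End ℤ L) v) := fun g v =>
      LinearMap.congr_fun (congrArg Units.val ((Commute.inv_right (hγ _ ⟨g, rfl⟩ :
        Commute (latticeHom ρ L hL g) γ)).eq)) v
    have key : ∀ δ : End ℤ L, (∀ g (v : L), (latticeHom ρ L hL g : End ℤ L) (δ v) =
        δ ((latticeHom ρ L hL g : End ℤ L) v)) → ∃ f : intCommutant ρ L, restrictHom ρ L f = δ := by
      intro δ hδ
      obtain ⟨f, hf⟩ := hfull.exists_extend (L.subtype ∘ₗ δ)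
      refine ⟨⟨f, mem_commutant.2 fun g => ?_, fun v hv => ?_⟩,
        LinearMap.ext fun v => Subtype.ext (hf v)⟩
      · refine LinearMap.congr_fun (f := f * ρ g) (g := ρ g * f) (hfull.ext fun v hv => ?_)
        have h1 := congrArg Subtype.val (hδ g ⟨v, hv⟩)
        rw [latticeHom_apply] at h1
        rw [Module.End.mul_apply, Module.End.mul_apply, hf ⟨v, hv⟩, hf ⟨ρ g v, hL g v hv⟩]
        exact h1.symm
      · rw [hf ⟨v, hv⟩]
        exact (δ _).2
    obtain ⟨f, hf⟩ := key _ hcomm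
    obtain ⟨f', hf'⟩ := key _ hcomm'
    refine ⟨⟨f, f', restrictHom_injective hfull ?_, restrictHom_injective hfull ?_⟩, Units.ext hf⟩
    · rw [map_mul, map_one, hf, hf', Units.mul_inv]
    · rw [map_mul, map_one, hf, hf', Units.inv_mul]
  · rintro ⟨u, rfl⟩ _ ⟨g, rfl⟩
    refine Units.ext (LinearMap.ext fun v => Subtype.ext ?_)
    exact (mem_commutant.1 (u : intCommutant ρ L).2.1 g v).symm

/-- The centralizer is the kernel of conjugation from the normalizer to the automorphisms of the
finite image of G. -/
theorem finite_latticeNormalizer_iff [Finite G] (hfull : IsFullLattice L)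
    (hL : ∀ (g : G), ∀ v ∈ L, ρ g v ∈ L) :
    Finite (latticeNormalizer ρ L hL) ↔ Finite (intCommutant ρ L)ˣ := by
  have hinj : Function.Injective (Units.map (restrictHom ρ L)) :=
    Units.map_injective (restrictHom_injective hfull)
  have hrange := centralizer_eq_range hfull hL
  have hle := Subgroup.centralizer_le_normalizer
    ((latticeHom ρ L hL).range : Set (LinearMap.GeneralLinearGroup ℤ L))
  constructor
  · intro h
    rw [hrange] at hle
    exact Finite.of_injective (fun u => (⟨_, hle ⟨u, rfl⟩⟩ : latticeNormalizer ρ L hL))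
      fun u v huv => hinj (congrArg Subtype.val huv)
  · intro h
    refine (MonoidHom.finite_iff_finite_ker_range
      (latticeHom ρ L hL).range.normalizerMonoidHom).2 ⟨?_, ?_⟩
    · have : Finite (Units.map (restrictHom ρ L)).range :=
        Finite.of_surjective _ (MonoidHom.rangeRestrict_surjective _)
      rw [Subgroup.normalizerMonoidHom_ker, hrange]
      exact Finite.of_injective (fun x => (⟨x.1.1, x.2⟩ : (Units.map (restrictHom ρ L)).range))
        fun x y hxy => by
          have h1 := congrArg Subtype.val hxy
          exact Subtype.ext (Subtype.ext h1)
    · have : Finite (latticeHom ρ L hL).range := Finite.of_surjective _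
        (latticeHom ρ L hL).rangeRestrict_surjective
      have : Finite (MulAut (latticeHom ρ L hL).range) :=
        Finite.of_injective (fun e : MulAut (latticeHom ρ L hL).range => (e : _ → _))
          DFunLike.coe_injective
      infer_instance

end Normalizer

/-! ### Finiteness in the rational multiplicity-free case -/

section FiniteUnits

variable {V G : Type*} [AddCommGroup V] [Module ℝ V] [Group G]
  {ρ : Representation ℝ G V} {L : Submodule ℤ V}

theorem isAtom_of_isIrreducible {U : Subrepresentation ρ}
    (hU : U.toRepresentation.IsIrreducible) : IsAtom U := by
  constructor
  · rintro rfl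
    obtain ⟨X, Y, hXY⟩ := hU.exists_pair_ne
    refine hXY (Subrepresentation.toSubmodule_injective ?_)
    have : Subsingleton (⊥ : Subrepresentation ρ).toSubmodule :=
      inferInstanceAs (Subsingleton (⊥ : Submodule ℝ V))
    exact Subsingleton.elim _ _
  · intro X hX
    let Y : Subrepresentation U.toRepresentation :=
      ⟨X.toSubmodule.comap U.toSubmodule.subtype, fun g _ hv => X.apply_mem_toSubmodule g hv⟩
    rcases hU.eq_bot_or_eq_top Y with h | h
    · refine le_bot_iff.1 fun x hx => ?_
      have h1 : (⟨x, hX.le hx⟩ : U.toSubmodule) ∈ Y := hx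
      rw [h] at h1
      exact congrArg Subtype.val (show (⟨x, hX.le hx⟩ : U.toSubmodule) = 0 from h1)
    · refine absurd (fun u hu => ?_) hX.not_ge
      have h1 : (⟨u, hu⟩ : U.toSubmodule) ∈ Y := by
        rw [h]
        exact Submodule.mem_top (R := ℝ)
      exact h1

theorem det_ne_zero_of_isIrreducible {W : Type*} [AddCommGroup W] [Module ℝ W]
    [FiniteDimensional ℝ W] {σ : Representation ℝ G W} (hσ : σ.IsIrreducible) {f : End ℝ W}
    (hf : f ∈ commutant σ) (h0 : f ≠ 0) : LinearMap.det f ≠ 0 := by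
  rw [Ne, LinearMap.det_eq_zero_iff_ker_ne_bot, not_not]
  rcases hσ.eq_bot_or_eq_top (kerSubrep f hf) with h | h
  · exact congrArg Subrepresentation.toSubmodule h
  · exact absurd (LinearMap.ker_eq_top.1 (congrArg Subrepresentation.toSubmodule h)) h0

/-- Commuting endomorphisms preserve the summands of a multiplicity-free decomposition. -/
theorem apply_mem_of_isEmpty_equiv {r : ℕ} {U : Fin r → Subrepresentation ρ}
    (hdecomp : DirectSum.IsInternal (fun i => (U i).toSubmodule))
    (hirr : ∀ i, (U i).toRepresentation.IsIrreducible)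
    (hne : ∀ i j, i ≠ j → IsEmpty ((U i).toRepresentation.Equiv (U j).toRepresentation))
    {f : End ℝ V} (hf : f ∈ commutant ρ) (i : Fin r) {u : V} (hu : u ∈ (U i).toSubmodule) :
    f u ∈ (U i).toSubmodule := by
  let E := LinearEquiv.ofBijective (DirectSum.coeLinearMap fun i => (U i).toSubmodule) hdecomp
  have hE : ∀ g v j, (E.symm (ρ g v) j : V) = ρ g (E.symm v j) := by
    intro g v j
    obtain ⟨x, rfl⟩ := E.surjective v
    induction x using DirectSum.induction_on with
    | zero => simp
    | of k w =>
      have h1 : E (DirectSum.of (fun i => (U i).toSubmodule) k w) = w :=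
        DirectSum.coeLinearMap_of (fun i => (U i).toSubmodule) k w
      rw [h1]
      by_cases hkj : k = j
      · subst hkj
        rw [hdecomp.ofBijective_coeLinearMap_of_mem w.2,
          hdecomp.ofBijective_coeLinearMap_of_mem ((U k).apply_mem_toSubmodule g w.2)]
      · rw [hdecomp.ofBijective_coeLinearMap_of_mem_ne hkj w.2,
          hdecomp.ofBijective_coeLinearMap_of_mem_ne hkj ((U k).apply_mem_toSubmodule g w.2)]
        simp
    | add x y hx hy => simp [hx, hy] at *
  -- The component of f from the i-th to the j-th summand intertwines non-isomorphic irreducibles,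
  -- so it vanishes by Schur's lemma.
  have hzero : ∀ j, i ≠ j → E.symm (f u) j = 0 := by
    intro j hij
    have := hne i j hij
    have := hirr i
    have := hirr j
    let φ : Representation.IntertwiningMap (U i).toRepresentation (U j).toRepresentation :=
      LinearMap.intertwiningMap_of_isIntertwiningMap _ _
        (DirectSum.component ℝ _ (fun i => (U i).toSubmodule) j ∘ₗ E.symm.toLinearMap ∘ₗ f ∘ₗ
          (U i).toSubmodule.subtype) (fun g v => Subtype.ext (by
            have h1 : f (ρ g v) = ρ g (f v) := mem_commutant.1 hf g v
            have h2 := hE g (f v) j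
            rw [← h1] at h2
            exact h2))
    have hφ : φ = 0 := Subsingleton.elim _ _
    exact DFunLike.congr_fun hφ ⟨u, hu⟩
  have h1 : E.symm (f u) = DirectSum.of (fun i => (U i).toSubmodule) i (E.symm (f u) i) := by
    refine DFinsupp.ext fun j => ?_
    by_cases hij : i = j
    · subst hij
      rw [DirectSum.of_eq_same]
    · rw [hzero j hij, DirectSum.of_eq_of_ne _ _ _ (Ne.symm hij)]
  have h2 : f u = (E.symm (f u) i : V) := by
    rw [← DirectSum.coeLinearMap_of (fun i => (U i).toSubmodule) i, ← h1]
    exact (E.apply_symm_apply _).symm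
  rw [h2]
  exact Subtype.prop _

theorem exists_basis_of_isRational [FiniteDimensional ℝ V] (hfull : IsFullLattice L)
    {U : Submodule ℝ V} (hU : IsRational L U) :
    ∃ (n : ℕ) (c : Basis (Fin n) ℝ U), ∀ w : U,
      w ∈ Submodule.span ℤ (Set.range c) ↔ (w : V) ∈ L := by
  obtain ⟨n, b, rfl⟩ := hfull
  obtain ⟨m, d, hd⟩ := hU
  obtain ⟨k, c, hc⟩ := exists_basis_span_int_eq (b.equivFun.toLinearMap ∘ₗ U.subtype)
    (b.equivFun.injective.comp U.injective_subtype)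
    ((Submodule.span ℤ (Set.range b)).comap (U.subtype.restrictScalars ℤ))
    (fun x hx i => by
      obtain ⟨z, hz⟩ := (b.mem_span_iff_repr_mem ℤ _).1 hx i
      exact ⟨z, hz.symm⟩)
    (by
      rw [eq_top_iff, ← d.span_eq]
      refine Submodule.span_mono ?_
      rintro _ ⟨i, rfl⟩
      exact hd i)
  exact ⟨k, c, fun w => by rw [hc]; rfl⟩

/-- A unit is determined by its restrictions to the summands. Each restriction preserves the lattice
of its summand and has determinant ±1, so finitely many are possible. -/
theorem finite_units_of_isRational [FiniteDimensional ℝ V] (hfull : IsFullLattice L)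
    {r : ℕ} {U : Fin r → Subrepresentation ρ}
    (hdecomp : DirectSum.IsInternal (fun i => (U i).toSubmodule))
    (hirr : ∀ i, (U i).toRepresentation.IsIrreducible)
    (hrat : ∀ i, IsRational L (U i).toSubmodule)
    (hne : ∀ i j, i ≠ j → IsEmpty ((U i).toRepresentation.Equiv (U j).toRepresentation)) :
    Finite (intCommutant ρ L)ˣ := by
  have hstable : ∀ f : intCommutant ρ L, ∀ i, ∀ u ∈ (U i).toSubmodule,
      (f : End ℝ V) u ∈ (U i).toSubmodule := fun f i u hu =>
    apply_mem_of_isEmpty_equiv hdecomp hirr hne f.2.1 i hu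
  let res : ∀ i, intCommutant ρ L → End ℝ (U i).toSubmodule := fun i f =>
    (f : End ℝ V).restrict (hstable f i)
  choose n c hc using fun i => exists_basis_of_isRational hfull (hrat i)
  let S : ∀ i, Set (End ℝ (U i).toSubmodule) := fun i =>
    {f ∈ Subalgebra.toSubmodule (commutant (U i).toRepresentation) |
      (∀ x ∈ Submodule.span ℤ (Set.range (c i)), f x ∈ Submodule.span ℤ (Set.range (c i))) ∧
      |LinearMap.det f| = 1}
  have hS : ∀ i, (S i).Finite := fun i => finite_abs_det_eq_one (c i) _
    fun f hf h0 => det_ne_zero_of_isIrreducible (hirr i) hf h0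
  have hpres : ∀ i f, ∀ x ∈ Submodule.span ℤ (Set.range (c i)),
      res i f x ∈ Submodule.span ℤ (Set.range (c i)) := fun i f x hx => by
    rw [hc] at hx ⊢
    exact f.2.2 _ hx
  have hmem : ∀ (u : (intCommutant ρ L)ˣ) i, res i u ∈ S i := by
    intro u i
    refine ⟨mem_commutant.2 fun g v =>
      Subtype.ext (mem_commutant.1 (u : intCommutant ρ L).2.1 g v), hpres i u, ?_⟩
    obtain ⟨d, _, hd, -⟩ := exists_int_det_adjugate (c i) _ (hpres i u)
    obtain ⟨d', _, hd', -⟩ := exists_int_det_adjugate (c i) _ (hpres i (u⁻¹ : (intCommutant ρ L)ˣ))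
    have h1 : res i u * res i (u⁻¹ : (intCommutant ρ L)ˣ) = 1 := by
      refine LinearMap.ext fun v => Subtype.ext ?_
      exact LinearMap.congr_fun (congrArg Subtype.val u.mul_inv) (v : V)
    have h2 : d * d' = 1 := by
      have := congrArg LinearMap.det h1
      rw [map_mul, map_one, hd, hd'] at this
      exact_mod_cast this
    rw [hd]
    exact_mod_cast Int.isUnit_iff_abs_eq.1 (IsUnit.of_mul_eq_one _ h2)
  have hfin : ∀ i, Finite (S i) := fun i => (hS i).to_subtype
  refine Finite.of_injective (β := ∀ i, S i) (fun u i => ⟨res i u, hmem u i⟩) fun u v huv => ?_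
  refine Units.ext (Subtype.ext ?_)
  have h1 : (⊤ : Submodule ℝ V) ≤ LinearMap.eqLocus ((u : intCommutant ρ L) : End ℝ V)
      ((v : intCommutant ρ L) : End ℝ V) := by
    rw [← hdecomp.submodule_iSup_eq_top]
    refine iSup_le fun i w hw => ?_
    exact congrArg Subtype.val (LinearMap.congr_fun
      (congrArg Subtype.val (congrFun huv i)) (⟨w, hw⟩ : (U i).toSubmodule))
  exact LinearMap.ext fun w => h1 trivial

end FiniteUnits

/-- The isomorphism composed with a projection onto `U` is a commuting endomorphism that moves the
rational `U` off itself. -/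
theorem infinite_units_of_equiv {V G : Type*} [AddCommGroup V] [Module ℝ V]
    [FiniteDimensional ℝ V] [Group G] [Finite G] {ρ : Representation ℝ G V}
    {L : Submodule ℤ V} (hfull : IsFullLattice L) (hL : ∀ (g : G), ∀ v ∈ L, ρ g v ∈ L)
    {U U' : Subrepresentation ρ} (hU : U ≠ ⊥) (hrat : IsRational L U.toSubmodule)
    (hdisj : Disjoint U.toSubmodule U'.toSubmodule)
    (φ : U.toRepresentation.Equiv U'.toRepresentation) : Infinite (intCommutant ρ L)ˣ := by
  obtain ⟨p, hp⟩ := exists_isProjOnto U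
  let x : End ℝ V := U'.toSubmodule.subtype ∘ₗ φ.toLinearEquiv.toLinearMap ∘ₗ
    p.codRestrict _ hp.apply_mem
  have hx : x ∈ commutant ρ := mem_commutant.2 fun g v => by
    have h1 : p.codRestrict _ hp.apply_mem (ρ g v) =
        U.toRepresentation g (p.codRestrict _ hp.apply_mem v) :=
      Subtype.ext (mem_commutant.1 hp.mem_commutant g v)
    simp only [x, LinearMap.comp_apply, h1]
    exact congrArg Subtype.val (Representation.IntertwiningMap.isIntertwining _ _ φ.toIntertwiningMap g _)
  obtain ⟨u, hu, hu0⟩ := U.toSubmodule.ne_bot_iff.1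
    fun h => hU (Subrepresentation.toSubmodule_injective h)
  refine infinite_units_of_not_mem hfull hL hrat hx hu fun hmem => hu0 ?_
  have h1 : x u = (φ.toLinearEquiv ⟨u, hu⟩ : V) :=
    congrArg (fun w => (φ.toLinearEquiv w : V)) (codRestrict_coe hp ⟨u, hu⟩)
  have h2 : x u = 0 := Submodule.disjoint_def.1 hdisj _ hmem (by rw [h1]; exact Subtype.prop _)
  rw [h1] at h2
  exact congrArg Subtype.val (φ.toLinearEquiv.map_eq_zero_iff.1 (Subtype.ext h2))

end LatticeRep

theorem theorem4p1 {V G : Type*} [AddCommGroup V] [Module ℝ V] [FiniteDimensional ℝ V]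
    [Group G] [Finite G] (ρ : Representation ℝ G V)
    (L : Submodule ℤ V) (hfull : LatticeRep.IsFullLattice L)
    (hL : ∀ (g : G), ∀ v ∈ L, ρ g v ∈ L)
    (r : ℕ) (U : Fin r → Subrepresentation ρ)
    (hdecomp : DirectSum.IsInternal (fun i => (U i).toSubmodule))
    (hirr : ∀ i, (U i).toRepresentation.IsIrreducible) :
    (Finite (LatticeRep.latticeNormalizer ρ L hL) ↔
      (∀ i, LatticeRep.IsRational L (U i).toSubmodule) ∧
      (∀ i j, i ≠ j → IsEmpty ((U i).toRepresentation.Equiv (U j).toRepresentation))) ∧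
    ((∃ W : Subrepresentation ρ, W.toSubmodule ≠ ⊥ ∧
        LatticeRep.IsIrrational L W.toSubmodule) →
      Infinite (LatticeRep.latticeNormalizer ρ L hL)) ∧
    ((∃ i j, i ≠ j ∧ Nonempty ((U i).toRepresentation.Equiv (U j).toRepresentation)) →
      Infinite (LatticeRep.latticeNormalizer ρ L hL)) := by
  have hatom := fun i => LatticeRep.isAtom_of_isIrreducible (hirr i)
  rw [← not_finite_iff_infinite, LatticeRep.finite_latticeNormalizer_iff hfull hL]
  have hrat : Finite (LatticeRep.intCommutant ρ L)ˣ → ∀ W : Subrepresentation ρ, IsAtom W →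
      LatticeRep.IsRational L W.toSubmodule := fun hfin W hW =>
    LatticeRep.isRational_of_isAtom hfull hL hfin hW
  have hmain : Finite (LatticeRep.intCommutant ρ L)ˣ ↔
      (∀ i, LatticeRep.IsRational L (U i).toSubmodule) ∧
      (∀ i j, i ≠ j → IsEmpty ((U i).toRepresentation.Equiv (U j).toRepresentation)) := by
    refine ⟨fun hfin => ⟨fun i => hrat hfin _ (hatom i), fun i j hij => ⟨fun φ => ?_⟩⟩,
      fun ⟨h1, h2⟩ => LatticeRep.finite_units_of_isRational hfull hdecomp hirr h1 h2⟩
    exact not_finite_iff_infinite.2 (LatticeRep.infinite_units_of_equiv hfull hL (hatom i).1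
      (hrat hfin _ (hatom i)) (hdecomp.submodule_iSupIndep.pairwiseDisjoint hij) φ) hfin
  refine ⟨hmain, ?_, ?_⟩
  · rintro ⟨W, hW, hWirr⟩ hfin
    have := LatticeRep.wellFoundedLT_subrepresentation (ρ := ρ)
    -- An irreducible subspace of `W` would be rational, hence spanned by its lattice points, of
    -- which `W` has only 0.
    obtain ⟨X, ⟨hXW, hX0⟩, hXmin⟩ := exists_minimal_of_wellFoundedLT
      (fun X : Subrepresentation ρ => X ≤ W ∧ X ≠ ⊥)
      ⟨W, le_rfl, fun h => hW (congrArg Subrepresentation.toSubmodule h)⟩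
    have hX : IsAtom X := ⟨hX0, fun Y hY => by
      by_contra hY0
      exact hY.not_ge (hXmin ⟨hY.le.trans hXW, hY0⟩ hY.le)⟩
    have h1 := (LatticeRep.isRational_iff _).1 (hrat hfin X hX)
    have h2 : (X.toSubmodule : Set V) ∩ L ⊆ {0} := fun v hv => by
      rw [← hWirr]
      exact ⟨hXW hv.1, hv.2⟩
    refine hX0 (le_bot_iff.1 fun x hx => ?_)
    have h3 := Submodule.span_mono h2 (h1 hx)
    rw [Submodule.span_zero_singleton] at h3
    exact h3
  · rintro ⟨i, j, hij, ⟨φ⟩⟩ hfin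
    exact (hmain.1 hfin).2 i j hij |>.false φ
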